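/- Let $F$ be a field. All nonassociative algebras are unital. For a nonassociative $F$-algebra $A$ with associator $(x,y,z)=(xy)z-x(yz)$, let $\mathrm{Nuc}(A)=\{x\in A : (x,A,A)=(A,x,A)=(A,A,x)=0\}$ be its nucleus, an associative $F$-algebra; let $\mathrm{Jac}$ denote the Jacobson radical, and put $\sigma(A)=\mathrm{Nuc}(A)/\mathrm{Jac}(\mathrm{Nuc}(A))$. The center of $A$ is the set of elements of $\mathrm{Nuc}(A)$ that commute with all elements of $A$. A module over a ring is minimally faithful if it is faithful and none of its proper sections (quotients of submodules, other than the module itself) is faithful. A nonzero finite dimensional nonassociative $F$-algebra $A$ with center $F\cdot 1$ is called semiassociative if there is an étale $F$-subalgebra $K\subseteq \mathrm{Nuc}(A)$ such that $A$ is minimally faithful as a module over $K\otimes_F K$ acting by $(k\otimes k')a=kak'$. An associative $F$-algebra $R$ is called separable if it is projective as a module over $R\otimes_F R^{\mathrm{op}}$. (1) If $A$ and $B$ are semiassociative $F$-algebras, then, as subspaces of $A\otimes_F B$, $$\mathrm{Jac}(\mathrm{Nuc}(A\otimes_F B))=\mathrm{Jac}(\mathrm{Nuc}(A))\otimes_F\mathrm{Nuc}(B)+\mathrm{Nuc}(A)\otimes_F\mathrm{Jac}(\mathrm{Nuc}(B)),$$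 and $\sigma(A\otimes_F B)\cong\sigma(A)\otimes_F\sigma(B)$ as $F$-algebras. (2) The isomorphism classes of semiassociative $F$-algebras form a monoid under $\otimes_F$, with identity the class of $F$, and so do the isomorphism classes of separable associative $F$-algebras; and $[A]\mapsto[\sigma(A)]$ is a well-defined monoid homomorphism from the former to the latter. -/

import Mathlib

open scoped TensorProduct

universe u v w

section Nucleus

variable (F : Type u) [Field F] (A : Type v) [NonAssocRing A] [Module F A]
  [SMulCommClass F A A] [IsScalarTower F A A]

/-- The nucleus of a (unital) nonassociative `F`-algebra `A`: the elements that associate with all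
pairs of elements of `A`, in the left, the middle and the right position. -/
def nucleus : Submodule F A where
  carrier := {x | (∀ a b : A, associator x a b = 0) ∧ (∀ a b : A, associator a x b = 0) ∧
    (∀ a b : A, associator a b x = 0)}
  zero_mem' := by simp [associator]
  add_mem' := by
    rintro x y ⟨hx1, hx2, hx3⟩ ⟨hy1, hy2, hy3⟩
    simp only [associator, sub_eq_zero, Set.mem_ofPred_eq] at *
    refine ⟨fun a b => ?_, fun a b => ?_, fun a b => ?_⟩ <;> simp [add_mul, mul_add, *]
  smul_mem' := by
    rintro c x ⟨hx1, hx2, hx3⟩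
    simp only [associator, sub_eq_zero, Set.mem_ofPred_eq] at *
    refine ⟨fun a b => ?_, fun a b => ?_, fun a b => ?_⟩ <;>
      simp [smul_mul_assoc, mul_smul_comm, *]

variable {F A} in
theorem mem_nucleus_iff {x : A} : x ∈ nucleus F A ↔ (∀ a b : A, x * a * b = x * (a * b)) ∧
    (∀ a b : A, a * x * b = a * (x * b)) ∧ (∀ a b : A, a * b * x = a * (b * x)) := by
  simp [nucleus, associator, sub_eq_zero]

theorem one_mem_nucleus : (1 : A) ∈ nucleus F A := by
  simp [mem_nucleus_iff]

variable {F A} in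
theorem mul_mem_nucleus {x y : A} (hx : x ∈ nucleus F A) (hy : y ∈ nucleus F A) :
    x * y ∈ nucleus F A := by
  rw [mem_nucleus_iff] at *
  obtain ⟨hx1, hx2, hx3⟩ := hx
  obtain ⟨hy1, hy2, hy3⟩ := hy
  refine ⟨fun a b => ?_, fun a b => ?_, fun a b => ?_⟩
  · rw [hx1, hx1, hy1, hx1]
  · rw [← hx2, hy2, hx2, ← hx1 y b]
  · rw [← hx2, hx3, hy3, ← hx2 b y, hy3]

/-- The nucleus is an associative ring with the operations of `A`. -/
instance nucleus.instRing : Ring (nucleus F A) where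
  __ := (inferInstance : AddCommGroup (nucleus F A))
  mul x y := ⟨x.1 * y.1, mul_mem_nucleus x.2 y.2⟩
  one := ⟨1, one_mem_nucleus F A⟩
  mul_assoc x y z := Subtype.ext ((mem_nucleus_iff.1 x.2).1 y.1 z.1)
  one_mul x := Subtype.ext (one_mul x.1)
  mul_one x := Subtype.ext (mul_one x.1)
  zero_mul x := Subtype.ext (zero_mul x.1)
  mul_zero x := Subtype.ext (mul_zero x.1)
  left_distrib x y z := Subtype.ext (mul_add x.1 y.1 z.1)
  right_distrib x y z := Subtype.ext (add_mul x.1 y.1 z.1)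

instance nucleus.instAlgebra : Algebra F (nucleus F A) :=
  Algebra.ofModule (fun c x y => Subtype.ext (smul_mul_assoc c x.1 y.1))
    (fun c x y => Subtype.ext (mul_smul_comm c x.1 y.1))

/-- The Jacobson radical of the nucleus of `A`, as a subspace of `A`. -/
def radNucleus : Submodule F A :=
  ((Ring.jacobson (nucleus F A)).restrictScalars F).map (nucleus F A).subtype

/-- `σ(A) = Nuc(A) / Jac(Nuc(A))`, an associative `F`-algebra. -/
abbrev SemisimpleQuotient : Type v :=
  nucleus F A ⧸ Ring.jacobson (nucleus F A)

end Nucleus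

/-- A module is minimally faithful if it is faithful and no section `P / Q` with `Q ≤ P ≤ M`,
other than `M` itself, is faithful. -/
def IsMinimallyFaithful (R : Type u) [Ring R] (M : Type v) [AddCommGroup M] [Module R M] : Prop :=
  FaithfulSMul R M ∧ ∀ Q P : Submodule R M, Q ≤ P → FaithfulSMul R (P ⧸ Q.submoduleOf P) →
    Q = ⊥ ∧ P = ⊤

section Semiassociative

open scoped IsMulCommutative

variable {F : Type u} [Field F] {A : Type v} [NonAssocRing A] [Module F A]
  [SMulCommClass F A A] [IsScalarTower F A A]

/-- Left multiplication of `A` by the elements of a subalgebra `K` of the nucleus. -/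
def nucleusLeftMul (K : Subalgebra F (nucleus F A)) : K →ₐ[F] Module.End F A :=
  AlgHom.ofLinearMap
    ((LinearMap.mul F A).comp ((nucleus F A).subtype.comp K.val.toLinearMap))
    (LinearMap.ext fun a => one_mul a)
    (fun x y => LinearMap.ext fun a => (mem_nucleus_iff.1 x.1.2).1 y.1.1 a)

/-- Right multiplication of `A` by the elements of a commutative subalgebra `K` of the nucleus. -/
def nucleusRightMul (K : Subalgebra F (nucleus F A)) [IsMulCommutative K] :
    K →ₐ[F] Module.End F A :=
  AlgHom.ofLinearMap
    ((LinearMap.mul F A).flip.comp ((nucleus F A).subtype.comp K.val.toLinearMap))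
    (LinearMap.ext fun a => mul_one a)
    (fun x y => LinearMap.ext fun a => by
      rw [mul_comm x y]
      exact ((mem_nucleus_iff.1 x.1.2).2.2 a y.1.1).symm)

/-- The action of `K ⊗ K` on `A` by `(k ⊗ k') a = k a k'`. -/
def nucleusBiMul (K : Subalgebra F (nucleus F A)) [IsMulCommutative K] :
    K ⊗[F] K →ₐ[F] Module.End F A :=
  Algebra.TensorProduct.lift (nucleusLeftMul K) (nucleusRightMul K)
    (fun x y => LinearMap.ext fun a => ((mem_nucleus_iff.1 x.1.2).1 a y.1.1).symm)

theorem nucleusBiMul_tmul (K : Subalgebra F (nucleus F A)) [IsMulCommutative K] (k k' : K)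
    (a : A) : nucleusBiMul K (k ⊗ₜ k') a = (k : nucleus F A) * a * (k' : nucleus F A) :=
  ((mem_nucleus_iff.1 k.1.2).1 a k'.1.1).symm

/-- `A` as a module over `K ⊗ K`. -/
abbrev nucleusBimodule (K : Subalgebra F (nucleus F A)) [IsMulCommutative K] :
    Module (K ⊗[F] K) A :=
  Module.compHom A (nucleusBiMul K).toRingHom

variable (F A) in
/-- Semiassociative algebras: finite dimensional central nonassociative `F`-algebras `A` that are
minimally faithful over `K ⊗ K` for some étale `F`-subalgebra `K` of the nucleus. -/
structure IsSemiassociative : Prop where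
  nontrivial : Nontrivial A
  finite : FiniteDimensional F A
  /-- The center is `F · 1`. (`Set.center` consists of the elements of the nucleus that commute
  with all elements.) -/
  central : Set.center A = Set.range (fun c : F => c • (1 : A))
  exists_etale : ∃ (K : Subalgebra F (nucleus F A)) (_ : IsMulCommutative K),
    Algebra.Etale F K ∧
      letI : Module (K ⊗[F] K) A := nucleusBimodule K
      IsMinimallyFaithful (K ⊗[F] K) A

end Semiassociative

/-- An associative `F`-algebra `R` is separable if it is projective as an `R ⊗ Rᵒᵖ`-module,
where `(r ⊗ s) x = r x s`. -/
def IsSeparableAlgebra (F : Type u) [Field F] (R : Type v) [Ring R] [Algebra F R] : Prop :=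
  letI : Module (R ⊗[F] Rᵐᵒᵖ) R := instModuleTensorProductMop F R
  Module.Projective (R ⊗[F] Rᵐᵒᵖ) R

/-- Bundled (unital) nonassociative `F`-algebras. -/
structure NonassocAlg (F : Type u) [Field F] where
  carrier : Type u
  [ring : NonAssocRing carrier]
  [module : Module F carrier]
  [smulComm : SMulCommClass F carrier carrier]
  [tower : IsScalarTower F carrier carrier]

/-- Bundled associative `F`-algebras. -/
structure AssocAlg (F : Type u) [Field F] where
  carrier : Type u
  [ring : Ring carrier]
  [algebra : Algebra F carrier]

attribute [instance] NonassocAlg.ring NonassocAlg.module NonassocAlg.smulComm NonassocAlg.tower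
attribute [instance] AssocAlg.ring AssocAlg.algebra

section Classes

variable (F : Type u) [Field F]

/-- Isomorphism of nonassociative algebras: a multiplicative linear equivalence. -/
def NonassocIso (A B : Type u) [NonAssocRing A] [Module F A] [NonAssocRing B] [Module F B] : Prop :=
  ∃ e : A ≃ₗ[F] B, ∀ x y, e (x * y) = e x * e y

instance NonassocAlg.setoid : Setoid (NonassocAlg F) where
  r A B := NonassocIso F A.carrier B.carrier
  iseqv :=
    { refl := fun A => ⟨LinearEquiv.refl F _, fun _ _ => rfl⟩
      symm := by
        rintro A B ⟨e, he⟩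
        exact ⟨e.symm, fun x y => e.injective (by simp [he])⟩
      trans := by
        rintro A B C ⟨e, he⟩ ⟨f, hf⟩
        exact ⟨e.trans f, fun x y => by simp [he, hf]⟩ }

/-- Isomorphism of associative algebras. -/
instance AssocAlg.setoid : Setoid (AssocAlg F) where
  r A B := Nonempty (A.carrier ≃ₐ[F] B.carrier)
  iseqv :=
    { refl := fun _ => ⟨AlgEquiv.refl⟩
      symm := fun ⟨e⟩ => ⟨e.symm⟩
      trans := fun ⟨e⟩ ⟨f⟩ => ⟨e.trans f⟩ }

/-- Isomorphism classes of nonassociative `F`-algebras. -/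
def NonassocClass : Type (u + 1) := Quotient (NonassocAlg.setoid F)

/-- Isomorphism classes of associative `F`-algebras. -/
def AssocClass : Type (u + 1) := Quotient (AssocAlg.setoid F)

variable {F}

/-- The isomorphism class of a nonassociative algebra. -/
def NonassocClass.mk (A : NonassocAlg F) : NonassocClass F := Quotient.mk _ A

/-- The isomorphism class of an associative algebra. -/
def AssocClass.mk (A : AssocAlg F) : AssocClass F := Quotient.mk _ A

/-- Tensor product over `F`. -/
def NonassocAlg.tensor (A B : NonassocAlg F) : NonassocAlg F := ⟨A.carrier ⊗[F] B.carrier⟩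

/-- Tensor product over `F`. -/
def AssocAlg.tensor (A B : AssocAlg F) : AssocAlg F := ⟨A.carrier ⊗[F] B.carrier⟩

section TensorIso

variable {A B C D : Type u}
  [NonAssocRing A] [Module F A] [SMulCommClass F A A] [IsScalarTower F A A]
  [NonAssocRing B] [Module F B] [SMulCommClass F B B] [IsScalarTower F B B]
  [NonAssocRing C] [Module F C] [SMulCommClass F C C] [IsScalarTower F C C]
  [NonAssocRing D] [Module F D] [SMulCommClass F D D] [IsScalarTower F D D]

theorem nonassocIso_of_tmul (e : A ⊗[F] B ≃ₗ[F] C)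
    (h : ∀ (a a' : A) (b b' : B), e ((a * a') ⊗ₜ (b * b')) = e (a ⊗ₜ b) * e (a' ⊗ₜ b')) :
    NonassocIso F (A ⊗[F] B) C := by
  refine ⟨e, fun x y => ?_⟩
  induction x using TensorProduct.induction_on with
  | zero => simp
  | add x x' hx hx' => simp [add_mul, hx, hx']
  | tmul a b =>
    induction y using TensorProduct.induction_on with
    | zero => simp
    | add y y' hy hy' => simp [mul_add, hy, hy']
    | tmul a' b' => simpa using h a a' b b'

theorem nonassocIso_congr (h : NonassocIso F A C) (h' : NonassocIso F B D) :
    NonassocIso F (A ⊗[F] B) (C ⊗[F] D) := by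
  obtain ⟨e, he⟩ := h
  obtain ⟨f, hf⟩ := h'
  exact nonassocIso_of_tmul (TensorProduct.congr e f) (by simp [he, hf])

theorem nonassocIso_assoc : NonassocIso F ((A ⊗[F] B) ⊗[F] C) (A ⊗[F] (B ⊗[F] C)) := by
  refine nonassocIso_of_tmul (TensorProduct.assoc F A B C) ?_
  intro x x' c c'
  induction x using TensorProduct.induction_on with
  | zero => simp
  | add x y hx hy => simp [add_mul, TensorProduct.add_tmul, hx, hy]
  | tmul a b =>
    induction x' using TensorProduct.induction_on with
    | zero => simp
    | add x y hx hy => simp [mul_add, TensorProduct.add_tmul, hx, hy]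
    | tmul a' b' => simp

theorem nonassocIso_comm : NonassocIso F (A ⊗[F] B) (B ⊗[F] A) :=
  nonassocIso_of_tmul (TensorProduct.comm F A B) (by simp)

theorem nonassocIso_lid : NonassocIso F (F ⊗[F] A) A := by
  refine nonassocIso_of_tmul (TensorProduct.lid F A) ?_
  intro a a' b b'
  simp [mul_comm a a', mul_smul, smul_mul_assoc, mul_smul_comm]

theorem nonassocIso_rid : NonassocIso F (A ⊗[F] F) A := by
  refine nonassocIso_of_tmul (TensorProduct.rid F A) ?_
  intro a a' b b'
  simp [mul_comm b b', mul_smul, smul_mul_assoc, mul_smul_comm]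

end TensorIso

/-- The commutative monoid of isomorphism classes of nonassociative `F`-algebras under the tensor
product over `F`, with identity the class of `F`. -/
instance NonassocClass.instCommMonoid : CommMonoid (NonassocClass F) where
  mul := Quotient.map₂ NonassocAlg.tensor (fun _ _ h _ _ h' => nonassocIso_congr h h')
  one := NonassocClass.mk ⟨F⟩
  mul_assoc := by
    rintro ⟨A⟩ ⟨B⟩ ⟨C⟩
    exact Quotient.sound nonassocIso_assoc
  one_mul := by
    rintro ⟨A⟩
    exact Quotient.sound nonassocIso_lid
  mul_one := by
    rintro ⟨A⟩
    exact Quotient.sound nonassocIso_rid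
  mul_comm := by
    rintro ⟨A⟩ ⟨B⟩
    exact Quotient.sound nonassocIso_comm

/-- The commutative monoid of isomorphism classes of associative `F`-algebras under the tensor
product over `F`, with identity the class of `F`. -/
instance AssocClass.instCommMonoid : CommMonoid (AssocClass F) where
  mul := Quotient.map₂ AssocAlg.tensor (by
    rintro A A' ⟨e⟩ B B' ⟨f⟩
    exact ⟨Algebra.TensorProduct.congr e f⟩)
  one := AssocClass.mk ⟨F⟩
  mul_assoc := by
    rintro ⟨A⟩ ⟨B⟩ ⟨C⟩
    exact Quotient.sound ⟨Algebra.TensorProduct.assoc F F F A.carrier B.carrier C.carrier⟩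
  one_mul := by
    rintro ⟨A⟩
    exact Quotient.sound ⟨Algebra.TensorProduct.lid F A.carrier⟩
  mul_one := by
    rintro ⟨A⟩
    exact Quotient.sound ⟨Algebra.TensorProduct.rid F F A.carrier⟩
  mul_comm := by
    rintro ⟨A⟩ ⟨B⟩
    exact Quotient.sound ⟨Algebra.TensorProduct.comm F A.carrier B.carrier⟩

/-- `σ(A)` as a bundled associative algebra. -/
def NonassocAlg.sigma (A : NonassocAlg F) : AssocAlg F := ⟨SemisimpleQuotient F A.carrier⟩

end Classes

/-! Over an imperfect field a tensor product of semisimple algebras can fail to be semisimple, so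
the crux is that `σ(A) ⊗ σ(B)` is semisimple. The étale subalgebra `K` supplies this.

Since `K ⊗ K` is étale over a field, it is commutative semisimple, and over such a ring minimally
faithful means free of rank one. Hence `A = (K ⊗ K) a`. Let `e` be the separability element of `K`.
It projects `A` onto elements commuting with `K`, and `e z = (μ(z) ⊗ 1) e` for the multiplication
`μ`, so the centralizer of `K` in `Nuc(A)` lies in `K · (e a)`. Counting dimensions, `K` is its own
centralizer (`mem_range_of_commute`). Averaging with `e` carries this to every quotient, and `K`
embeds in `σ(A)` because `K` is reduced and the radical is nilpotent.

Now let `S`, `S'` be semisimple with self-centralizing étale subalgebras `K`, `K'`. A nonzero ideal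
of `S ⊗ S'` meets `K ⊗ S'` (`exists_rTensor_mem_of_ne_bot`), and the same argument in the other
factor shows that it meets `K ⊗ K'`. That ring is reduced, so the nilpotent radical of `S ⊗ S'`
vanishes (`isSemisimpleRing_tensorProduct`). With `S' = Sᵐᵒᵖ` this gives separability of `σ(A)`.

Slicing with linear functionals gives `Nuc(A ⊗ B) = Nuc(A) ⊗ Nuc(B)`. The kernel of `Nuc(A) ⊗ Nuc(B)
→ σ(A) ⊗ σ(B)` is the sum in the statement; it lies in the radical by nilpotence and contains it
because the target is semisimple. The monoid statements follow from closure of both classes under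
tensor products and isomorphisms. -/

/-! ### Minimally faithful modules over commutative semisimple rings -/

section MinimallyFaithful

/-- A faithful module over a commutative semisimple ring contains an element with zero
annihilator. -/
theorem exists_smul_injective_of_faithfulSMul (T : Type*) [CommRing T] [IsSemisimpleRing T]
    (M : Type*) [AddCommGroup M] [Module T M] [FaithfulSMul T M] :
    ∃ m : M, ∀ t : T, t • m = 0 → t = 0 := by
  -- Choose `m` with minimal annihilator, generated by an idempotent `e`. If `e ≠ 0`, then `m` can
  -- be improved.
  obtain ⟨I, ⟨m, rfl⟩, hmin⟩ := wellFounded_lt.has_min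
    (Set.range fun m : M => LinearMap.ker (LinearMap.toSpanSingleton T M m)) ⟨_, 0, rfl⟩
  obtain ⟨e, he, hI⟩ := IsSemisimpleRing.ideal_eq_span_idempotent
    (LinearMap.ker (LinearMap.toSpanSingleton T M m))
  have hem : e • m = 0 := by
    have : e ∈ LinearMap.ker (LinearMap.toSpanSingleton T M m) :=
      hI ▸ Ideal.mem_span_singleton_self e
    simpa using this
  have hmem (t : T) (ht : t • m = 0) : ∃ s, t = s * e := by
    have : t ∈ LinearMap.ker (LinearMap.toSpanSingleton T M m) := by simpa using ht
    rw [hI] at this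
    obtain ⟨s, hs⟩ := Ideal.mem_span_singleton'.1 this
    exact ⟨s, hs.symm⟩
  have he0 : e = 0 := by
    by_contra hne
    obtain ⟨m', hm'⟩ : ∃ m' : M, e • m' ≠ 0 := by
      by_contra! h
      exact hne (FaithfulSMul.eq_of_smul_eq_smul (α := M) fun a => by rw [h a, zero_smul])
    -- As `e` kills `m`, the vectors `m` and `e • m'` lie in complementary summands: anything
    -- killing the sum kills both, while `e` kills only `m`.
    refine hmin _ ⟨m + e • m', rfl⟩ (lt_of_le_of_ne (fun t ht => ?_) fun h => ?_)
    · have ht : t • m + t • e • m' = 0 := by simpa using ht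
      have h1 : e • (t • m + t • e • m') = t • e • m' := by
        rw [smul_add, smul_comm e t m, hem, smul_zero, zero_add, smul_comm e t, smul_smul e e,
          he.eq]
      rw [ht, smul_zero] at h1
      rw [← h1, add_zero] at ht
      simpa using ht
    · have : e ∈ LinearMap.ker (LinearMap.toSpanSingleton T M (m + e • m')) := by
        have h : LinearMap.ker (LinearMap.toSpanSingleton T M (m + e • m')) =
          LinearMap.ker (LinearMap.toSpanSingleton T M m) := h
        rw [h]
        simpa using hem
      simp only [LinearMap.mem_ker, LinearMap.toSpanSingleton_apply, smul_add, hem, zero_add,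
        smul_smul, he.eq] at this
      exact hm' this
  refine ⟨m, fun t ht => ?_⟩
  obtain ⟨s, rfl⟩ := hmem t ht
  rw [he0, mul_zero]

/-- A minimally faithful module over a commutative semisimple ring is free of rank one. -/
theorem IsMinimallyFaithful.exists_smul_bijective {T : Type*} [CommRing T] [IsSemisimpleRing T]
    {M : Type*} [AddCommGroup M] [Module T M] (h : IsMinimallyFaithful T M) :
    ∃ m : M, Function.Bijective fun t : T => t • m := by
  obtain ⟨hf, hmin⟩ := h
  obtain ⟨m, hm⟩ := exists_smul_injective_of_faithfulSMul T M
  have hinj : Function.Injective fun t : T => t • m := fun s t hst =>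
    sub_eq_zero.1 (hm _ (by rw [sub_smul, sub_eq_zero]; exact hst))
  -- The cyclic submodule on `m` is already faithful, so by minimality it is everything.
  have hP := (hmin ⊥ (Submodule.span T {m}) bot_le ?_).2
  · refine ⟨m, hinj, fun a => ?_⟩
    exact Submodule.mem_span_singleton.1 (hP ▸ Submodule.mem_top : a ∈ Submodule.span T {m})
  · refine ⟨fun {s t} hst => hinj ?_⟩
    have := hst (Submodule.Quotient.mk ⟨m, Submodule.mem_span_singleton_self m⟩)
    rw [← Submodule.Quotient.mk_smul, ← Submodule.Quotient.mk_smul, Submodule.Quotient.eq,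
      Submodule.submoduleOf, Submodule.mem_comap, Submodule.mem_bot] at this
    simpa [sub_eq_zero] using this

/-- Over a commutative ring that is semisimple and finite dimensional over a field, a free module
of rank one is minimally faithful. -/
theorem isMinimallyFaithful_of_smul_bijective (F : Type*) [Field F] {T : Type*} [CommRing T]
    [Algebra F T] [FiniteDimensional F T] [IsSemisimpleRing T] {M : Type*} [AddCommGroup M]
    [Module T M] (m : M) (hm : Function.Bijective fun t : T => t • m) :
    IsMinimallyFaithful T M := by
  refine ⟨⟨fun {s t} hst => hm.1 (hst m)⟩, fun Q P hQP hf => ?_⟩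
  let : Module F M := Module.compHom M (algebraMap F T)
  have : IsScalarTower F T M := ⟨fun c t a => by
    rw [Algebra.smul_def, mul_smul]; rfl⟩
  obtain ⟨x, hx⟩ := exists_smul_injective_of_faithfulSMul T (P ⧸ Q.submoduleOf P)
  let g : T →ₗ[F] M := (LinearMap.toSpanSingleton T M m).restrictScalars F
  let g' : T ≃ₗ[F] M := LinearEquiv.ofBijective g hm
  have : FiniteDimensional F M := g'.finiteDimensional
  let f : T →ₗ[F] (P ⧸ Q.submoduleOf P) :=
    (LinearMap.toSpanSingleton T (P ⧸ Q.submoduleOf P) x).restrictScalars F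
  have hfinj : Function.Injective f := by
    rw [injective_iff_map_eq_zero]
    exact fun t ht => hx t ht
  have : FiniteDimensional F P := Module.Finite.of_injective
    (P.subtype.restrictScalars F) P.injective_subtype
  let q : P →ₗ[F] (P ⧸ Q.submoduleOf P) := (Q.submoduleOf P).mkQ.restrictScalars F
  have hq : Function.Surjective q := (Q.submoduleOf P).mkQ_surjective
  have : FiniteDimensional F (P ⧸ Q.submoduleOf P) := Module.Finite.of_surjective q hq
  -- A faithful section contains a copy of `T`, so its dimension is at least that of `M`; nothing
  -- can have been cut away.
  have h1 := LinearMap.finrank_le_finrank_of_injective hfinj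
  have h2 := LinearMap.finrank_le_finrank_of_surjective hq
  have h3 := LinearMap.finrank_le_finrank_of_injective
    (f := P.subtype.restrictScalars F) P.injective_subtype
  have h4 := g'.finrank_eq
  have hqinj : Function.Injective q :=
    (LinearMap.injective_iff_surjective_of_finrank_eq_finrank (by omega)).2 hq
  have hPsurj : Function.Surjective (P.subtype.restrictScalars F) :=
    (LinearMap.injective_iff_surjective_of_finrank_eq_finrank (by omega)).1 P.injective_subtype
  constructor
  · rw [eq_bot_iff]
    intro a ha
    have h0 : q ⟨a, hQP ha⟩ = 0 := (Submodule.Quotient.mk_eq_zero _).2 ha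
    rw [← map_zero q] at h0
    simpa using congrArg Subtype.val (hqinj h0)
  · rw [eq_top_iff]
    intro a _
    obtain ⟨p, rfl⟩ := hPsurj a
    exact p.2

end MinimallyFaithful

/-! ### Semisimple algebras with a self-centralizing separable subalgebra -/

section SelfCentralizing

variable {F : Type*} [Field F] {K : Type*} [CommRing K] [Algebra F K]
  {S : Type*} [Ring S] [Algebra F S]

/-- The action `(k ⊗ k') s = ι k * s * ι k'` of `K ⊗ K` on an algebra `S`. -/
noncomputable def bimulHom (ι : K →ₐ[F] S) : K ⊗[F] K →ₐ[F] Module.End F S :=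
  (AlgHom.mulLeftRight F S).comp
    (Algebra.TensorProduct.map ι ((AlgHom.op ι).comp (AlgEquiv.toOpposite F K).toAlgHom))

@[simp]
theorem bimulHom_tmul (ι : K →ₐ[F] S) (k k' : K) (s : S) :
    bimulHom ι (k ⊗ₜ k') s = ι k * s * ι k' := by
  simp [bimulHom]

/-- On the centralizer of `K` the left and right actions agree, so `K ⊗ K` acts through its
multiplication map. -/
theorem bimulHom_apply_of_commute (ι : K →ₐ[F] S) {s : S} (hs : ∀ k, ι k * s = s * ι k)
    (z : K ⊗[F] K) : bimulHom ι z s = s * ι (Algebra.TensorProduct.lmul' F z) := by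
  induction z with
  | zero => simp
  | add x y hx hy => simp [hx, hy, mul_add]
  | tmul k k' => simp [hs, mul_assoc]

theorem map_bimulHom (ι : K →ₐ[F] S) {S' : Type*} [Ring S'] [Algebra F S'] (f : S →ₐ[F] S')
    (z : K ⊗[F] K) (s : S) : f (bimulHom ι z s) = bimulHom (f.comp ι) z (f s) := by
  induction z with
  | zero => simp
  | add x y hx hy => simp [hx, hy]
  | tmul k k' => simp

theorem bimulHom_mem (ι : K →ₐ[F] S) (O : Subalgebra F (Module.End F S))
    (hl : ∀ a, LinearMap.mulLeft F a ∈ O) (hr : ∀ a, LinearMap.mulRight F a ∈ O)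
    (z : K ⊗[F] K) : bimulHom ι z ∈ O := by
  induction z with
  | zero => simp
  | add x y hx hy => simpa using O.add_mem hx hy
  | tmul k k' =>
    have : bimulHom ι (k ⊗ₜ k') = LinearMap.mulRight F (ι k') * LinearMap.mulLeft F (ι k) := by
      ext s; simp
    rw [this]
    exact O.mul_mem (hr _) (hl _)

variable [Algebra.FormallyUnramified F K] [Algebra.EssFiniteType F K]

-- This is `(1 ⊗ k) e = (k ⊗ 1) e` for the separability element `e`. As `e` also multiplies out to
-- `1`, its action is a projection of `S` onto the centralizer of `K`.
variable (F K) in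
open Algebra.FormallyUnramified in
theorem bimulHom_elem_commute (ι : K →ₐ[F] S) (s : S) (k : K) :
    ι k * bimulHom ι (elem F K) s = bimulHom ι (elem F K) s * ι k := by
  have h := congrArg (fun z => bimulHom ι z s) (one_tmul_mul_elem (R := F) k)
  simpa using h.symm

open Algebra.FormallyUnramified in
theorem bimulHom_elem_of_commute (ι : K →ₐ[F] S) {s : S} (hs : ∀ k, ι k * s = s * ι k) :
    bimulHom ι (elem F K) s = s := by
  rw [bimulHom_apply_of_commute ι hs, lmul_elem, map_one, mul_one]

/-- A separable subalgebra that is its own centralizer remains so in every quotient. -/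
theorem mem_range_of_commute_of_surjective (ι : K →ₐ[F] S) {S' : Type*} [Ring S'] [Algebra F S']
    (f : S →ₐ[F] S') (hf : Function.Surjective f)
    (hC : ∀ s, (∀ k, ι k * s = s * ι k) → s ∈ ι.range)
    (s' : S') (hs' : ∀ k, f.comp ι k * s' = s' * f.comp ι k) : s' ∈ (f.comp ι).range := by
  obtain ⟨s, rfl⟩ := hf s'
  -- An arbitrary lift `s` need not centralize `K`, but its average does, and the average still maps
  -- to `s'`, which averaging fixes.
  obtain ⟨k, hk⟩ := hC _ (bimulHom_elem_commute F K ι s)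
  refine ⟨k, ?_⟩
  have hk : ι k = _ := hk
  have := congrArg f hk
  rw [map_bimulHom, bimulHom_elem_of_commute _ hs'] at this
  exact this

/-- A nonzero two-sided ideal of a semisimple ring contains a nonzero central element. -/
theorem exists_central_mem_of_ne_bot {S : Type*} [Ring S] [IsSemisimpleRing S] (I : Ideal S)
    [I.IsTwoSided] (hI : I ≠ ⊥) : ∃ f ∈ I, f ≠ 0 ∧ ∀ s, f * s = s * f := by
  obtain ⟨f, hf, hIf⟩ := IsSemisimpleRing.ideal_eq_span_idempotent I
  have hfI : f ∈ I := hIf ▸ Ideal.mem_span_singleton_self f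
  have hx {x : S} (hx : x ∈ I) : x * f = x := by
    rw [hIf, Ideal.mem_span_singleton'] at hx
    obtain ⟨a, rfl⟩ := hx
    rw [mul_assoc, hf.eq]
  refine ⟨f, hfI, ?_, fun s => ?_⟩
  · rintro rfl
    exact hI (by rw [hIf]; simp)
  · have h1 : f * s * f = f * s := hx (I.mul_mem_right s hfI)
    -- The goal is `y = (1 - f) s f = 0`. Since `f` is a right identity on `I` and `f y = 0`, all of
    -- `I` kills `y` from the left.
    obtain ⟨y, hy⟩ : ∃ y, y = s * f - f * s * f := ⟨_, rfl⟩
    have hyI : y ∈ I := hy ▸ I.sub_mem (I.mul_mem_left _ hfI) (I.mul_mem_left _ hfI)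
    have hfy : f * y = 0 := by
      rw [hy, mul_sub, ← mul_assoc, ← mul_assoc, ← mul_assoc, hf.eq, sub_self]
    obtain ⟨g, hg, hyg⟩ := IsSemisimpleRing.ideal_eq_span_idempotent (Ideal.span {y})
    have hgy : g ∈ Ideal.span {y} := hyg ▸ Ideal.mem_span_singleton_self g
    obtain ⟨a, ha⟩ := Ideal.mem_span_singleton'.1 hgy
    have hIy {x : S} (hxI : x ∈ I) : x * y = 0 := by rw [← hx hxI, mul_assoc, hfy, mul_zero]
    -- With `g = a y` one has `g = g² = a (y a) y`, and `y a ∈ I`.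
    have hg0 : g = 0 := by
      rw [← hg.eq, ← ha, mul_assoc, ← mul_assoc y, hIy (I.mul_mem_right a hyI), mul_zero]
    have hy0 : y = 0 := by
      have : y ∈ Ideal.span {g} := hyg ▸ Ideal.mem_span_singleton_self y
      simpa [hg0] using this
    rw [hy, sub_eq_zero] at hy0
    rw [hy0, h1]

open Algebra.FormallyUnramified in
/-- Let `S` be a semisimple algebra in which the separable subalgebra `K` is its own centralizer.
A nonzero subspace of `S ⊗ W` stable under multiplications by `S` on both sides meets `K ⊗ W`. -/
theorem exists_rTensor_mem_of_ne_bot [IsSemisimpleRing S] (ι : K →ₐ[F] S)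
    (hι : Function.Injective ι) (hC : ∀ s, (∀ k, ι k * s = s * ι k) → s ∈ ι.range)
    {W : Type*} [AddCommGroup W] [Module F W] (N : Submodule F (S ⊗[F] W))
    (hl : ∀ a, ∀ x ∈ N, (LinearMap.mulLeft F a).rTensor W x ∈ N)
    (hr : ∀ a, ∀ x ∈ N, (LinearMap.mulRight F a).rTensor W x ∈ N) (hN : N ≠ ⊥) :
    ∃ y : K ⊗[F] W, ι.toLinearMap.rTensor W y ∈ N ∧ ι.toLinearMap.rTensor W y ≠ 0 := by
  classical
  -- The operators on `S` that preserve `N` when extended to `S ⊗ W`; they include all left and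
  -- right multiplications.
  let O : Subalgebra F (Module.End F S) :=
    { carrier := {θ | ∀ x ∈ N, θ.rTensor W x ∈ N}
      mul_mem' := fun {a b} ha hb x hx => by
        rw [LinearMap.rTensor_mul]; exact ha _ (hb _ hx)
      add_mem' := fun {a b} ha hb x hx => by
        rw [LinearMap.rTensor_add]; exact N.add_mem (ha _ hx) (hb _ hx)
      algebraMap_mem' := fun c x hx => by
        rw [Algebra.algebraMap_eq_smul_one, LinearMap.rTensor_smul]
        rw [LinearMap.smul_apply, Module.End.one_eq_id, LinearMap.rTensor_id]
        exact N.smul_mem c hx }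
  obtain ⟨x, hxN, hx0⟩ := N.ne_bot_iff.1 hN
  let b := Module.Free.chooseBasis F W
  let e := TensorProduct.equivFinsuppOfBasisRight (M := S) b
  have he (θ : S →ₗ[F] S) (z : S ⊗[F] W) i : e (θ.rTensor W z) i = θ (e z i) := by
    induction z with
    | zero => simp
    | add z w hz hw => simp [hz, hw]
    | tmul s w => simp [e]
  obtain ⟨i, hi⟩ : ∃ i, e x i ≠ 0 := by
    by_contra! h
    exact hx0 (e.map_eq_zero_iff.1 (Finsupp.ext h))
  -- The orbit of one nonzero coordinate of `x` is a nonzero two-sided ideal, so some operator sends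
  -- that coordinate to a nonzero central `f`.
  let I : Ideal S :=
    { carrier := {t | ∃ θ ∈ O, θ (e x i) = t}
      zero_mem' := ⟨0, O.zero_mem, rfl⟩
      add_mem' := by
        rintro _ _ ⟨θ, hθ, rfl⟩ ⟨θ', hθ', rfl⟩
        exact ⟨θ + θ', O.add_mem hθ hθ', rfl⟩
      smul_mem' := by
        rintro a _ ⟨θ, hθ, rfl⟩
        exact ⟨LinearMap.mulLeft F a * θ, O.mul_mem (hl a) hθ, rfl⟩ }
  have : I.IsTwoSided := ⟨by
    rintro _ a ⟨θ, hθ, rfl⟩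
    exact ⟨LinearMap.mulRight F a * θ, O.mul_mem (hr a) hθ, rfl⟩⟩
  have hI : I ≠ ⊥ := fun h => hi (by
    have : e x i ∈ I := ⟨1, O.one_mem, rfl⟩
    simpa [h] using this)
  obtain ⟨f, ⟨θ, hθ, hθf⟩, hf0, hfc⟩ := exists_central_mem_of_ne_bot I hI
  -- Averaging after `θ` pushes every coordinate into the centralizer of `K`, that is into `K`, and
  -- leaves the central `f` unchanged, so the result stays nonzero.
  obtain ⟨θ', hθ'⟩ : ∃ θ', θ' = bimulHom ι (elem F K) * θ := ⟨_, rfl⟩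
  have hθ'O : θ' ∈ O := hθ' ▸ O.mul_mem (bimulHom_mem ι O hl hr _) hθ
  have hθ'r (s : S) : θ' s ∈ LinearMap.range ι.toLinearMap := by
    rw [hθ']
    exact hC _ (bimulHom_elem_commute F K ι _)
  let g : S →ₗ[F] K :=
    (LinearEquiv.ofInjective ι.toLinearMap hι).symm.toLinearMap ∘ₗ θ'.codRestrict _ hθ'r
  have hg : ι.toLinearMap ∘ₗ g = θ' := by
    ext s
    exact congrArg Subtype.val ((LinearEquiv.ofInjective ι.toLinearMap hι).apply_symm_apply
      ⟨θ' s, hθ'r s⟩)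
  have hy : ι.toLinearMap.rTensor W (g.rTensor W x) = θ'.rTensor W x := by
    rw [← LinearMap.comp_apply, ← LinearMap.rTensor_comp, hg]
  refine ⟨g.rTensor W x, hy ▸ hθ'O x hxN, fun h0 => hf0 ?_⟩
  rw [hy] at h0
  have := he θ' x i
  rw [h0, hθ', Module.End.mul_apply, hθf, bimulHom_elem_of_commute ι fun k => (hfc _).symm] at this
  simpa using this.symm

theorem rTensor_mulLeft_apply {F S S' : Type*} [Field F] [Ring S] [Algebra F S] [Ring S']
    [Algebra F S'] (a : S) (x : S ⊗[F] S') :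
    (LinearMap.mulLeft F a).rTensor S' x = (a ⊗ₜ[F] (1 : S')) * x := by
  induction x with
  | zero => simp
  | add x y hx hy => simp [mul_add, hx, hy]
  | tmul s s' => simp

theorem rTensor_mulRight_apply {F S S' : Type*} [Field F] [Ring S] [Algebra F S] [Ring S']
    [Algebra F S'] (a : S) (x : S ⊗[F] S') :
    (LinearMap.mulRight F a).rTensor S' x = x * (a ⊗ₜ[F] (1 : S')) := by
  induction x with
  | zero => simp
  | add x y hx hy => simp [add_mul, hx, hy]
  | tmul s s' => simp

/-- The tensor product of semisimple algebras with self-centralizing separable subalgebras is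
semisimple. -/
theorem isSemisimpleRing_tensorProduct [FiniteDimensional F S] [IsSemisimpleRing S]
    (ι : K →ₐ[F] S) (hι : Function.Injective ι)
    (hC : ∀ s, (∀ k, ι k * s = s * ι k) → s ∈ ι.range)
    {K' : Type*} [CommRing K'] [Algebra F K']
    [Algebra.FormallyUnramified F K'] [Algebra.EssFiniteType F K']
    {S' : Type*} [Ring S'] [Algebra F S'] [FiniteDimensional F S'] [IsSemisimpleRing S']
    (ι' : K' →ₐ[F] S') (hι' : Function.Injective ι')
    (hC' : ∀ s, (∀ k, ι' k * s = s * ι' k) → s ∈ ι'.range) :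
    IsSemisimpleRing (S ⊗[F] S') := by
  have : IsArtinianRing (S ⊗[F] S') := IsArtinianRing.of_finite F _
  rw [IsArtinianRing.isSemisimpleRing_iff_jacobson]
  by_contra hJ
  obtain ⟨I, hIdef⟩ : ∃ I, I = Ring.jacobson (S ⊗[F] S') := ⟨_, rfl⟩
  have hIts : I.IsTwoSided := hIdef ▸ inferInstance
  have hnil : IsNilpotent I := hIdef ▸ IsSemiprimaryRing.isNilpotent
  rw [← hIdef] at hJ
  have hIN : I.restrictScalars F ≠ ⊥ := fun h => hJ (by
    rw [eq_bot_iff]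
    intro x hx
    have : x ∈ I.restrictScalars F := hx
    simpa [h] using this)
  -- First descent: the radical meets `K ⊗ S'`.
  obtain ⟨y, hyI, hy0⟩ := exists_rTensor_mem_of_ne_bot ι hι hC (I.restrictScalars F)
    (fun a x hx => by
      rw [rTensor_mulLeft_apply]
      exact I.mul_mem_left _ hx)
    (fun a x hx => by
      rw [rTensor_mulRight_apply]
      exact I.mul_mem_right _ hx) hIN
  let φ : K ⊗[F] K' →ₐ[F] S ⊗[F] S' := Algebra.TensorProduct.map ι ι'
  let h : S' ⊗[F] K →ₐ[F] S ⊗[F] S' :=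
    (Algebra.TensorProduct.map ι (AlgHom.id F S')).comp
      (Algebra.TensorProduct.comm F S' K).toAlgHom
  have hh (a : S') : h (a ⊗ₜ 1) = 1 ⊗ₜ a := by simp [h]
  have hhφ (z : K' ⊗[F] K) : h (ι'.toLinearMap.rTensor K z) = φ (TensorProduct.comm F K' K z) := by
    induction z with
    | zero => simp
    | add x y hx hy => simp [hx, hy]
    | tmul s s' => simp [h, φ]
  have hN' : (I.restrictScalars F).comap h.toLinearMap ≠ ⊥ := by
    rw [Submodule.ne_bot_iff]
    refine ⟨TensorProduct.comm F K S' y, ?_, fun h0 => hy0 ?_⟩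
    · have : h (TensorProduct.comm F K S' y) = ι.toLinearMap.rTensor S' y := by
        clear hyI hy0
        induction y with
        | zero => simp
        | add x y hx hy => simp [hx, hy]
        | tmul s s' => simp [h]
      change h (TensorProduct.comm F K S' y) ∈ I
      rw [this]
      exact hyI
    · rw [LinearEquiv.map_eq_zero_iff] at h0
      rw [h0, map_zero]
  -- Second descent, with factors swapped: the trace of the radical on `S' ⊗ K` is stable under `S'`
  -- on both sides, so it meets `K' ⊗ K`.
  obtain ⟨z, hzI, hz0⟩ := exists_rTensor_mem_of_ne_bot ι' hι' hC'
    ((I.restrictScalars F).comap h.toLinearMap)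
    (fun a x hx => by
      rw [rTensor_mulLeft_apply]
      change h _ ∈ I
      rw [map_mul]
      exact I.mul_mem_left _ hx)
    (fun a x hx => by
      rw [rTensor_mulRight_apply]
      change h _ ∈ I
      rw [map_mul]
      exact I.mul_mem_right _ hx) hN'
  have hzI : h (ι'.toLinearMap.rTensor K z) ∈ I := hzI
  rw [hhφ] at hzI
  obtain ⟨n, hn⟩ := hnil
  have hpow : φ (TensorProduct.comm F K' K z ^ n) = 0 := by
    have : φ (TensorProduct.comm F K' K z) ^ n ∈ I ^ n := Ideal.pow_mem_pow hzI n
    rw [hn] at this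
    rw [map_pow]
    exact this
  have hφ : Function.Injective φ :=
    TensorProduct.map_injective_of_flat_flat ι.toLinearMap ι'.toLinearMap hι hι'
  have : Algebra.FormallyUnramified F (K ⊗[F] K') := .comp F K _
  have : Algebra.EssFiniteType F (K ⊗[F] K') := .comp F K _
  have : IsReduced (K ⊗[F] K') := Algebra.FormallyUnramified.isReduced_of_field F _
  have h0 : TensorProduct.comm F K' K z = 0 :=
    eq_zero_of_pow_eq_zero (hφ (hpow.trans (map_zero φ).symm))
  rw [LinearEquiv.map_eq_zero_iff] at h0
  exact hz0 (by rw [h0, map_zero])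

/-- A semisimple algebra with a self-centralizing separable subalgebra is separable. -/
theorem isSeparableAlgebra_of_selfCentralizing [FiniteDimensional F S] [IsSemisimpleRing S]
    (ι : K →ₐ[F] S) (hι : Function.Injective ι)
    (hC : ∀ s, (∀ k, ι k * s = s * ι k) → s ∈ ι.range) : IsSeparableAlgebra F S := by
  have : IsSemisimpleRing (S ⊗[F] Sᵐᵒᵖ) := isSemisimpleRing_tensorProduct ι hι hC
    ((AlgHom.op ι).comp (AlgEquiv.toOpposite F K).toAlgHom)
    (fun x y hxy => hι (by simpa using hxy))
    (fun s hs => by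
      obtain ⟨k, hk⟩ := hC s.unop fun k => by
        have := congrArg MulOpposite.unop (hs k)
        simpa using this.symm
      exact ⟨k, by simpa using congrArg MulOpposite.op hk⟩)
  let : Module (S ⊗[F] Sᵐᵒᵖ) S := instModuleTensorProductMop F S
  exact Module.projective_of_isSemisimpleRing (S ⊗[F] Sᵐᵒᵖ) S

end SelfCentralizing

/-! ### Separability elements and closure properties of separable algebras -/

section Separable

variable {F : Type*} [Field F] {R : Type*} [Ring R] [Algebra F R]

/-- An algebra is separable if and only if it has a separability element. -/
theorem isSeparableAlgebra_iff_exists_separabilityElement {F : Type u} [Field F] {R : Type v}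
    [Ring R] [Algebra F R] : IsSeparableAlgebra F R ↔ ∃ E : R ⊗[F] Rᵐᵒᵖ,
      AlgHom.mulLeftRight F R E 1 = 1 ∧ ∀ a : R, (a ⊗ₜ 1) * E = (1 ⊗ₜ MulOpposite.op a) * E := by
  let : Module (R ⊗[F] Rᵐᵒᵖ) R := instModuleTensorProductMop F R
  have hsmul (z : R ⊗[F] Rᵐᵒᵖ) (x : R) : z • x = AlgHom.mulLeftRight F R z x := rfl
  constructor
  · intro h
    have h : Module.Projective (R ⊗[F] Rᵐᵒᵖ) R := h
    obtain ⟨s, hs⟩ := Module.projective_lifting_property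
      (LinearMap.toSpanSingleton (R ⊗[F] Rᵐᵒᵖ) R 1) LinearMap.id fun r =>
        ⟨r ⊗ₜ 1, by simp [hsmul]⟩
    -- `s` splits `z ↦ z • 1`. Linearity of `s` gives the centrality of `s 1`, since `a ⊗ 1` and `1
    -- ⊗ op a` act equally on `1`.
    refine ⟨s 1, LinearMap.congr_fun hs 1, fun a => ?_⟩
    rw [← smul_eq_mul, ← smul_eq_mul, ← map_smul, ← map_smul]
    congr 1
    simp [hsmul]
  · rintro ⟨E, hE, hc⟩
    let s : R →ₗ[R ⊗[F] Rᵐᵒᵖ] R ⊗[F] Rᵐᵒᵖ :=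
      { toFun := fun r => (r ⊗ₜ 1) * E
        map_add' := fun x y => by rw [TensorProduct.add_tmul, add_mul]
        map_smul' := fun z r => by
          induction z with
          | zero => simp [hsmul]
          | add x y hx hy =>
            simp only [RingHom.id_apply] at hx hy ⊢
            rw [add_smul, TensorProduct.add_tmul, add_mul, add_smul, hx, hy]
          | tmul a b =>
            rw [hsmul, AlgHom.mulLeftRight_apply, RingHom.id_apply, smul_eq_mul]
            have h1 : ((a * r * b.unop) ⊗ₜ[F] (1 : Rᵐᵒᵖ)) =
                (a * r) ⊗ₜ 1 * b.unop ⊗ₜ 1 := by simp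
            rw [h1, mul_assoc, hc, ← mul_assoc, ← mul_assoc]
            simp }
    refine Module.Projective.of_split s (LinearMap.toSpanSingleton (R ⊗[F] Rᵐᵒᵖ) R 1) ?_
    refine LinearMap.ext fun r => ?_
    change AlgHom.mulLeftRight F R ((r ⊗ₜ 1) * E) 1 = r
    rw [map_mul, Module.End.mul_apply, hE]
    simp

variable (F) in
theorem isSeparableAlgebra_self : IsSeparableAlgebra F F :=
  isSeparableAlgebra_iff_exists_separabilityElement.2 ⟨1, by simp, fun a => by
    have := TensorProduct.smul_tmul (R := F) a (1 : F) (1 : Fᵐᵒᵖ)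
    rw [mul_one, mul_one]
    simpa [← MulOpposite.op_smul, ← MulOpposite.op_one] using this⟩

theorem mulLeftRight_map {R' : Type*} [Ring R'] [Algebra F R'] (f : R →ₐ[F] R')
    (z : R ⊗[F] Rᵐᵒᵖ) (x : R) :
    AlgHom.mulLeftRight F R' (Algebra.TensorProduct.map f (AlgHom.op f) z) (f x) =
      f (AlgHom.mulLeftRight F R z x) := by
  induction z with
  | zero => simp
  | add x y hx hy => simp [hx, hy]
  | tmul a b => simp

theorem IsSeparableAlgebra.of_algEquiv {R' : Type*} [Ring R'] [Algebra F R'] (e : R ≃ₐ[F] R')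
    (h : IsSeparableAlgebra F R) : IsSeparableAlgebra F R' := by
  obtain ⟨E, hE, hc⟩ := isSeparableAlgebra_iff_exists_separabilityElement.1 h
  refine isSeparableAlgebra_iff_exists_separabilityElement.2
    ⟨Algebra.TensorProduct.map e.toAlgHom (AlgHom.op e.toAlgHom) E, ?_, fun a => ?_⟩
  · have := mulLeftRight_map e.toAlgHom E 1
    rw [hE, map_one] at this
    exact this
  · have := congrArg (Algebra.TensorProduct.map e.toAlgHom (AlgHom.op e.toAlgHom)) (hc (e.symm a))
    simpa using this

/-- The tensor product of separable algebras is separable. -/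
theorem IsSeparableAlgebra.tensorProduct {R' : Type*} [Ring R'] [Algebra F R']
    (h : IsSeparableAlgebra F R) (h' : IsSeparableAlgebra F R') :
    IsSeparableAlgebra F (R ⊗[F] R') := by
  obtain ⟨E, hE, hc⟩ := isSeparableAlgebra_iff_exists_separabilityElement.1 h
  obtain ⟨E', hE', hc'⟩ := isSeparableAlgebra_iff_exists_separabilityElement.1 h'
  let Φ : (R ⊗[F] Rᵐᵒᵖ) ⊗[F] (R' ⊗[F] R'ᵐᵒᵖ) →ₐ[F] (R ⊗[F] R') ⊗[F] (R ⊗[F] R')ᵐᵒᵖ :=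
    (Algebra.TensorProduct.map (AlgHom.id F _)
      (Algebra.TensorProduct.opAlgEquiv F F R R').toAlgHom).comp
      (Algebra.TensorProduct.tensorTensorTensorComm F F F F R Rᵐᵒᵖ R' R'ᵐᵒᵖ).toAlgHom
  have hΦ (a : R) (b : Rᵐᵒᵖ) (a' : R') (b' : R'ᵐᵒᵖ) :
      Φ ((a ⊗ₜ b) ⊗ₜ (a' ⊗ₜ b')) = (a ⊗ₜ a') ⊗ₜ MulOpposite.op (b.unop ⊗ₜ b'.unop) := by
    simp [Φ]
  have hΦ1 (z : R ⊗[F] Rᵐᵒᵖ) (z' : R' ⊗[F] R'ᵐᵒᵖ) :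
      AlgHom.mulLeftRight F (R ⊗[F] R') (Φ (z ⊗ₜ z')) 1 =
        AlgHom.mulLeftRight F R z 1 ⊗ₜ AlgHom.mulLeftRight F R' z' 1 := by
    induction z with
    | zero => simp
    | add x y hx hy => simp [TensorProduct.add_tmul, hx, hy]
    | tmul a b =>
      induction z' with
      | zero => simp
      | add x y hx hy => simp [TensorProduct.tmul_add, hx, hy]
      | tmul a' b' => rw [hΦ]; simp
  refine isSeparableAlgebra_iff_exists_separabilityElement.2 ⟨Φ (E ⊗ₜ E'), ?_, fun x => ?_⟩
  · rw [hΦ1, hE, hE']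
    rfl
  · induction x with
    | zero => simp
    | add x y hx hy =>
      rw [TensorProduct.add_tmul, MulOpposite.op_add, TensorProduct.tmul_add, add_mul, add_mul,
        hx, hy]
    | tmul a a' =>
      have h1 : (a ⊗ₜ a') ⊗ₜ 1 = Φ ((a ⊗ₜ 1) ⊗ₜ (a' ⊗ₜ 1)) := by rw [hΦ]; rfl
      have h2 : 1 ⊗ₜ MulOpposite.op (a ⊗ₜ a') =
        Φ ((1 ⊗ₜ MulOpposite.op a) ⊗ₜ (1 ⊗ₜ MulOpposite.op a')) := by rw [hΦ]; rfl
      rw [h1, h2, ← map_mul, ← map_mul, Algebra.TensorProduct.tmul_mul_tmul,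
        Algebra.TensorProduct.tmul_mul_tmul, hc, hc']

end Separable

/-! ### Slices of tensors -/

section Slices

variable {F : Type*} [Field F] {V W : Type*} [AddCommGroup V] [Module F V]
  [AddCommGroup W] [Module F W]

/-- Contraction of the right factor of a tensor product with a linear functional. -/
noncomputable def rightSlice (V : Type*) [AddCommGroup V] [Module F V] (φ : W →ₗ[F] F) :
    V ⊗[F] W →ₗ[F] V :=
  (TensorProduct.rid F V).toLinearMap ∘ₗ φ.lTensor V

@[simp]
theorem rightSlice_tmul (φ : W →ₗ[F] F) (v : V) (w : W) : rightSlice V φ (v ⊗ₜ w) = φ w • v := by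
  simp [rightSlice]

/-- Contraction of the left factor of a tensor product with a linear functional. -/
noncomputable def leftSlice (W : Type*) [AddCommGroup W] [Module F W] (φ : V →ₗ[F] F) :
    V ⊗[F] W →ₗ[F] W :=
  (TensorProduct.lid F W).toLinearMap ∘ₗ φ.rTensor W

@[simp]
theorem leftSlice_tmul (φ : V →ₗ[F] F) (v : V) (w : W) : leftSlice W φ (v ⊗ₜ w) = φ v • w := by
  simp [leftSlice]

/-- The coefficients of `x` in a basis of `W` are its slices by the coordinate functionals. -/
theorem exists_rTensor_subtype_eq (P : Submodule F V) (x : V ⊗[F] W)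
    (hx : ∀ φ : W →ₗ[F] F, rightSlice V φ x ∈ P) : ∃ y : P ⊗[F] W, P.subtype.rTensor W y = x := by
  classical
  let b := Module.Free.chooseBasis F W
  let e := TensorProduct.equivFinsuppOfBasisRight (M := V) b
  have he (z : V ⊗[F] W) i : e z i = rightSlice V (b.coord i) z := by
    induction z with
    | zero => simp
    | add z w hz hw => simp [hz, hw]
    | tmul s w => simp [e]
  have hP (i) : e x i ∈ P := he x i ▸ hx _
  refine ⟨∑ i ∈ (e x).support, (⟨e x i, hP i⟩ : P) ⊗ₜ b i, ?_⟩
  refine Eq.trans ?_ (e.symm_apply_apply x)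
  rw [map_sum, TensorProduct.equivFinsuppOfBasisRight_symm_apply, Finsupp.sum]
  rfl

/-- A tensor all of whose slices lie in `P` and in `Q` lies in `P ⊗ Q`. -/
theorem exists_map_subtype_eq (P : Submodule F V) (Q : Submodule F W) (x : V ⊗[F] W)
    (hx : ∀ φ : W →ₗ[F] F, rightSlice V φ x ∈ P) (hx' : ∀ φ : V →ₗ[F] F, leftSlice W φ x ∈ Q) :
    ∃ y : P ⊗[F] Q, TensorProduct.map P.subtype Q.subtype y = x := by
  obtain ⟨y, rfl⟩ := exists_rTensor_subtype_eq P x hx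
  obtain ⟨z, hz⟩ := exists_rTensor_subtype_eq Q (TensorProduct.comm F P W y) fun φ => by
    -- Functionals on `P` extend to `V`, so slices of `y` are slices of the original tensor.
    obtain ⟨ψ, hψ⟩ := LinearMap.exists_extend φ
    convert hx' ψ using 1
    clear hx hx'
    induction y with
    | zero => simp
    | add z w hz hw => simp [hz, hw]
    | tmul p w => simp [← hψ]
  refine ⟨TensorProduct.comm F Q P z, ?_⟩
  rw [← LinearMap.rTensor_comp_lTensor, LinearMap.comp_apply]
  congr 1
  apply (TensorProduct.comm F P W).injective
  rw [← hz]
  clear hz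
  induction z with
  | zero => simp
  | add z w hz hw => simp [hz, hw]
  | tmul p w => simp

end Slices

/-! ### Nucleus and center of a tensor product -/

section TensorNucleus

variable {F : Type u} [Field F] {A : Type v} {B : Type w}
  [NonAssocRing A] [Module F A] [SMulCommClass F A A] [IsScalarTower F A A]
  [NonAssocRing B] [Module F B] [SMulCommClass F B B] [IsScalarTower F B B]

theorem rightSlice_mul_tmul_one (φ : B →ₗ[F] F) (x : A ⊗[F] B) (a : A) :
    rightSlice A φ (x * a ⊗ₜ 1) = rightSlice A φ x * a := by
  induction x with
  | zero => simp
  | add x y hx hy => simp [add_mul, hx, hy]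
  | tmul a' b => simp [smul_mul_assoc]

theorem rightSlice_tmul_one_mul (φ : B →ₗ[F] F) (x : A ⊗[F] B) (a : A) :
    rightSlice A φ (a ⊗ₜ 1 * x) = a * rightSlice A φ x := by
  induction x with
  | zero => simp
  | add x y hx hy => simp [mul_add, hx, hy]
  | tmul a' b => simp [mul_smul_comm]

theorem leftSlice_mul_one_tmul (φ : A →ₗ[F] F) (x : A ⊗[F] B) (b : B) :
    leftSlice B φ (x * 1 ⊗ₜ b) = leftSlice B φ x * b := by
  induction x with
  | zero => simp
  | add x y hx hy => simp [add_mul, hx, hy]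
  | tmul a' b => simp [smul_mul_assoc]

theorem leftSlice_one_tmul_mul (φ : A →ₗ[F] F) (x : A ⊗[F] B) (b : B) :
    leftSlice B φ (1 ⊗ₜ b * x) = b * leftSlice B φ x := by
  induction x with
  | zero => simp
  | add x y hx hy => simp [mul_add, hx, hy]
  | tmul a' b => simp [mul_smul_comm]

/-- Slicing off `B` commutes with multiplication by `a ⊗ 1`, so each nuclear identity of `x` tested
on such elements passes to its slices. -/
theorem rightSlice_mem_nucleus (φ : B →ₗ[F] F) {x : A ⊗[F] B} (hx : x ∈ nucleus F (A ⊗[F] B)) :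
    rightSlice A φ x ∈ nucleus F A := by
  rw [mem_nucleus_iff] at *
  obtain ⟨h1, h2, h3⟩ := hx
  have key (a b : A) : (a * b) ⊗ₜ[F] (1 : B) = a ⊗ₜ 1 * b ⊗ₜ 1 := by simp
  refine ⟨fun a b => ?_, fun a b => ?_, fun a b => ?_⟩
  · rw [← rightSlice_mul_tmul_one, ← rightSlice_mul_tmul_one, h1, ← rightSlice_mul_tmul_one, key]
  · rw [← rightSlice_tmul_one_mul, ← rightSlice_mul_tmul_one, h2, rightSlice_tmul_one_mul,
      rightSlice_mul_tmul_one]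
  · rw [← rightSlice_tmul_one_mul, key, h3, rightSlice_tmul_one_mul, rightSlice_tmul_one_mul]

theorem leftSlice_mem_nucleus (φ : A →ₗ[F] F) {x : A ⊗[F] B} (hx : x ∈ nucleus F (A ⊗[F] B)) :
    leftSlice B φ x ∈ nucleus F B := by
  rw [mem_nucleus_iff] at *
  obtain ⟨h1, h2, h3⟩ := hx
  have key (a b : B) : (1 : A) ⊗ₜ[F] (a * b) = 1 ⊗ₜ a * 1 ⊗ₜ b := by simp
  refine ⟨fun a b => ?_, fun a b => ?_, fun a b => ?_⟩
  · rw [← leftSlice_mul_one_tmul, ← leftSlice_mul_one_tmul, h1, ← leftSlice_mul_one_tmul, key]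
  · rw [← leftSlice_one_tmul_mul, ← leftSlice_mul_one_tmul, h2, leftSlice_one_tmul_mul,
      leftSlice_mul_one_tmul]
  · rw [← leftSlice_one_tmul_mul, key, h3, leftSlice_one_tmul_mul, leftSlice_one_tmul_mul]

theorem tmul_mem_nucleus {a : A} {b : B} (ha : a ∈ nucleus F A) (hb : b ∈ nucleus F B) :
    a ⊗ₜ b ∈ nucleus F (A ⊗[F] B) := by
  rw [mem_nucleus_iff] at *
  obtain ⟨ha1, ha2, ha3⟩ := ha
  obtain ⟨hb1, hb2, hb3⟩ := hb
  refine ⟨fun x y => ?_, fun x y => ?_, fun x y => ?_⟩ <;>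
  · induction x with
    | zero => simp
    | add x x' hx hx' => simp only [mul_add, add_mul, hx, hx']
    | tmul a' b' =>
      induction y with
      | zero => simp
      | add y y' hy hy' => simp only [mul_add, add_mul, hy, hy']
      | tmul a'' b'' => simp only [Algebra.TensorProduct.tmul_mul_tmul, *]

variable (F A B) in
/-- The inclusion `Nuc(A) ⊗ Nuc(B) → Nuc(A ⊗ B)`, a linear map. -/
noncomputable def nucleusTensorMap :
    nucleus F A ⊗[F] nucleus F B →ₗ[F] nucleus F (A ⊗[F] B) :=
  (TensorProduct.map (nucleus F A).subtype (nucleus F B).subtype).codRestrict _ fun x => by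
    induction x with
    | zero => simp
    | add x y hx hy => simpa using add_mem hx hy
    | tmul a b => simpa using tmul_mem_nucleus a.2 b.2

variable (F A B) in
/-- The nucleus of a tensor product is the tensor product of the nuclei. -/
noncomputable def nucleusTensorEquiv :
    nucleus F A ⊗[F] nucleus F B ≃ₐ[F] nucleus F (A ⊗[F] B) :=
  Algebra.TensorProduct.algEquivOfLinearEquivTensorProduct
    (LinearEquiv.ofBijective (nucleusTensorMap F A B) ⟨fun x y hxy =>
      TensorProduct.map_injective_of_flat_flat _ _ (nucleus F A).injective_subtype
        (nucleus F B).injective_subtype (congrArg Subtype.val hxy), fun x => by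
      obtain ⟨y, hy⟩ := exists_map_subtype_eq (nucleus F A) (nucleus F B) x.1
        (fun φ => rightSlice_mem_nucleus φ x.2) (fun φ => leftSlice_mem_nucleus φ x.2)
      exact ⟨y, Subtype.ext hy⟩⟩)
    (fun a a' b b' => Subtype.ext (Algebra.TensorProduct.tmul_mul_tmul a.1 a'.1 b.1 b'.1).symm) rfl

theorem coe_nucleusTensorEquiv (x : nucleus F A ⊗[F] nucleus F B) :
    (nucleusTensorEquiv F A B x : A ⊗[F] B) =
      TensorProduct.map (nucleus F A).subtype (nucleus F B).subtype x := rfl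

theorem mem_center_iff_mem_nucleus {x : A} :
    x ∈ Set.center A ↔ x ∈ nucleus F A ∧ ∀ a, x * a = a * x := by
  rw [Set.mem_center_iff, isMulCentral_iff, mem_nucleus_iff]
  constructor
  · rintro ⟨h1, h2, h3⟩
    have h1' (a) : x * a = a * x := h1 a
    refine ⟨⟨fun a b => (h2 a b).symm, fun a b => ?_, h3⟩, h1'⟩
    rw [← h1', ← h2, h1', h3, h1' b]
  · rintro ⟨⟨h1, h2, h3⟩, h⟩
    exact ⟨h, fun a b => (h1 a b).symm, h3⟩

theorem smul_one_mem_center (c : F) : c • (1 : A) ∈ Set.center A :=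
  mem_center_iff_mem_nucleus.2
    ⟨(nucleus F A).smul_mem c (one_mem_nucleus F A), fun a => by
      rw [smul_mul_assoc, mul_smul_comm, one_mul, mul_one]⟩

/-- The tensor product of central nonassociative algebras is central. -/
theorem center_tensorProduct (hA : Set.center A = Set.range fun c : F => c • (1 : A))
    (hB : Set.center B = Set.range fun c : F => c • (1 : B)) :
    Set.center (A ⊗[F] B) = Set.range fun c : F => c • (1 : A ⊗[F] B) := by
  apply Set.Subset.antisymm
  · intro x hx
    obtain ⟨hxn, hxc⟩ := mem_center_iff_mem_nucleus (F := F).1 hx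
    obtain ⟨y, rfl⟩ := exists_map_subtype_eq (Submodule.span F {(1 : A)})
      (Submodule.span F {(1 : B)}) x
      (fun φ => by
        rw [Submodule.mem_span_singleton]
        have : rightSlice A φ x ∈ Set.center A :=
          mem_center_iff_mem_nucleus.2 ⟨rightSlice_mem_nucleus φ hxn, fun a => by
            rw [← rightSlice_mul_tmul_one, hxc, rightSlice_tmul_one_mul]⟩
        rwa [hA] at this)
      (fun φ => by
        rw [Submodule.mem_span_singleton]
        have : leftSlice B φ x ∈ Set.center B :=
          mem_center_iff_mem_nucleus.2 ⟨leftSlice_mem_nucleus φ hxn, fun a => by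
            rw [← leftSlice_mul_one_tmul, hxc, leftSlice_one_tmul_mul]⟩
        rwa [hB] at this)
    clear hx hxn hxc
    induction y with
    | zero => exact ⟨0, by simp⟩
    | add x y hx hy =>
      obtain ⟨c, hc⟩ := hx
      obtain ⟨d, hd⟩ := hy
      exact ⟨c + d, by rw [map_add, ← hc, ← hd]; exact add_smul c d _⟩
    | tmul a b =>
      obtain ⟨c, hc⟩ := Submodule.mem_span_singleton.1 a.2
      obtain ⟨d, hd⟩ := Submodule.mem_span_singleton.1 b.2
      refine ⟨c * d, ?_⟩
      simp only [TensorProduct.map_tmul, Submodule.subtype_apply, ← hc, ← hd]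
      rw [TensorProduct.smul_tmul_smul]
      rfl
  · rintro _ ⟨c, rfl⟩
    exact smul_one_mem_center c

end TensorNucleus

/-! ### Étale subalgebras of the nucleus that make `A` free of rank one -/

section EtaleWitness

variable {F : Type u} [Field F] {A : Type v} [NonAssocRing A] [Module F A]
  [SMulCommClass F A A] [IsScalarTower F A A] {K : Type*} [CommRing K] [Algebra F K]

theorem nucleus.coe_one : ((1 : nucleus F A) : A) = 1 := rfl

theorem nucleus.coe_mul (x y : nucleus F A) : ((x * y : nucleus F A) : A) = x * y := rfl

/-- The action `(k ⊗ k') a = ι k * a * ι k'` on `A` of `K ⊗ K`, where `ι` maps `K` to the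
nucleus of `A`. -/
noncomputable def nucleusActionHom (ι : K →ₐ[F] nucleus F A) :
    K ⊗[F] K →ₐ[F] Module.End F A :=
  Algebra.TensorProduct.lift
    (AlgHom.ofLinearMap
      ((LinearMap.mul F A).comp ((nucleus F A).subtype.comp ι.toLinearMap))
      (LinearMap.ext fun a => by simp [nucleus.coe_one])
      (fun x y => LinearMap.ext fun a => by
        simpa [nucleus.coe_mul] using (mem_nucleus_iff.1 (ι x).2).1 (ι y).1 a))
    (AlgHom.ofLinearMap
      ((LinearMap.mul F A).flip.comp ((nucleus F A).subtype.comp ι.toLinearMap))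
      (LinearMap.ext fun a => by simp [nucleus.coe_one])
      (fun x y => LinearMap.ext fun a => by
        rw [mul_comm x y]
        simpa [nucleus.coe_mul] using ((mem_nucleus_iff.1 (ι x).2).2.2 a (ι y).1).symm))
    (fun x y => LinearMap.ext fun a => ((mem_nucleus_iff.1 (ι x).2).1 a (ι y).1).symm)

theorem nucleusActionHom_tmul (ι : K →ₐ[F] nucleus F A) (k k' : K) (a : A) :
    nucleusActionHom ι (k ⊗ₜ k') a = (ι k).1 * a * (ι k').1 :=
  ((mem_nucleus_iff.1 (ι k).2).1 a (ι k').1).symm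

theorem etale_tensorProduct {K' : Type*} [CommRing K'] [Algebra F K'] [Algebra.Etale F K]
    [Algebra.Etale F K'] : Algebra.Etale F (K ⊗[F] K') :=
  .comp F K _

variable (F K) in
theorem finiteDimensional_of_etale [Algebra.Etale F K] : FiniteDimensional F K :=
  Algebra.FormallyUnramified.finite_of_free F K

variable (F K) in
theorem isSemisimpleRing_of_etale [Algebra.Etale F K] : IsSemisimpleRing K := by
  have := finiteDimensional_of_etale F K
  have : IsArtinianRing K := IsArtinianRing.of_finite F _
  have : IsReduced K := Algebra.FormallyUnramified.isReduced_of_field F _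
  exact IsArtinianRing.isSemisimpleRing_of_isReduced K

/-- If `ι k = 0`, then `k ⊗ 1` kills `a`, hence vanishes; multiplying out recovers `k = 0`. -/
theorem injective_of_nucleusActionHom_injective (ι : K →ₐ[F] nucleus F A) (a : A)
    (h : Function.Injective fun z => nucleusActionHom ι z a) : Function.Injective ι := by
  rw [injective_iff_map_eq_zero]
  intro k hk
  have h0 : k ⊗ₜ[F] (1 : K) = 0 := h (by
    simp only [nucleusActionHom_tmul, hk, map_zero, LinearMap.zero_apply]
    simp)
  have := congrArg (Algebra.TensorProduct.lmul' F) h0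
  simpa using this

open scoped IsMulCommutative in
/-- A semiassociative algebra is free of rank one over `K ⊗ K` for an étale subalgebra `K` of
the nucleus. -/
theorem IsSemiassociative.exists_bijective (h : IsSemiassociative F A) :
    ∃ (K : Type v) (_ : CommRing K) (_ : Algebra F K) (_ : Algebra.Etale F K)
      (ι : K →ₐ[F] nucleus F A) (a : A), Function.Bijective fun z => nucleusActionHom ι z a := by
  obtain ⟨K, hK, het, hmin⟩ := h.exists_etale
  have : Algebra.Etale F (K ⊗[F] K) := etale_tensorProduct
  have := isSemisimpleRing_of_etale F (K ⊗[F] K)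
  let : Module (K ⊗[F] K) A := nucleusBimodule K
  obtain ⟨a, ha⟩ := hmin.exists_smul_bijective
  refine ⟨K, inferInstance, inferInstance, het, K.val, a, ?_⟩
  convert ha using 2 with z
  change _ = nucleusBiMul K z a
  induction z with
  | zero => simp
  | add x y hx hy => simp only [map_add, LinearMap.add_apply, hx, hy]
  | tmul k k' => rw [nucleusActionHom_tmul, nucleusBiMul_tmul]; rfl

-- Converse of `IsSemiassociative.exists_bijective`. It lets semiassociativity be checked with an
-- abstract étale `K` mapping to the nucleus, the action being transported to the image.
open scoped IsMulCommutative in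
theorem exists_etale_of_bijective [Algebra.Etale F K] (ι : K →ₐ[F] nucleus F A) (a : A)
    (h : Function.Bijective fun z => nucleusActionHom ι z a) :
    ∃ (K : Subalgebra F (nucleus F A)) (_ : IsMulCommutative K), Algebra.Etale F K ∧
      letI : Module (K ⊗[F] K) A := nucleusBimodule K
      IsMinimallyFaithful (K ⊗[F] K) A := by
  have hι := injective_of_nucleusActionHom_injective ι a h.1
  have hcomm : IsMulCommutative ι.range := ⟨⟨by
    rintro ⟨_, x, rfl⟩ ⟨_, y, rfl⟩
    exact Subtype.ext (by
      change ι x * ι y = ι y * ι x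
      rw [← map_mul, mul_comm, map_mul])⟩⟩
  let e : K ≃ₐ[F] ι.range := AlgEquiv.ofInjective ι hι
  have het : Algebra.Etale F ι.range := .of_equiv e
  refine ⟨ι.range, hcomm, het, ?_⟩
  have : Algebra.Etale F (ι.range ⊗[F] ι.range) := etale_tensorProduct
  have := isSemisimpleRing_of_etale F (ι.range ⊗[F] ι.range)
  have := finiteDimensional_of_etale F (ι.range ⊗[F] ι.range)
  let : Module (ι.range ⊗[F] ι.range) A := nucleusBimodule ι.range
  refine isMinimallyFaithful_of_smul_bijective F a ?_
  have key (z : K ⊗[F] K) : nucleusBiMul ι.range (Algebra.TensorProduct.congr e e z) a =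
      nucleusActionHom ι z a := by
    induction z with
    | zero => simp
    | add x y hx hy => simp only [map_add, LinearMap.add_apply, hx, hy]
    | tmul k k' =>
      rw [nucleusActionHom_tmul, Algebra.TensorProduct.congr_apply,
        Algebra.TensorProduct.map_tmul, nucleusBiMul_tmul]
      rfl
  have key' : (fun z : K ⊗[F] K => nucleusActionHom ι z a) =
      (fun t : ι.range ⊗[F] ι.range => nucleusBiMul ι.range t a) ∘
        Algebra.TensorProduct.congr e e := funext fun z => (key z).symm
  rw [key', Function.Bijective.of_comp_iff _ (Algebra.TensorProduct.congr e e).bijective] at h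
  exact h

open Algebra.FormallyUnramified in
/-- If `A` is cyclic over `K ⊗ K`, then `K` is its own centralizer in the nucleus of `A`. -/
theorem mem_range_of_commute [Algebra.Etale F K] (ι : K →ₐ[F] nucleus F A) (a : A)
    (h : Function.Bijective fun z => nucleusActionHom ι z a) (r : nucleus F A)
    (hr : ∀ k, ι k * r = r * ι k) : r ∈ ι.range := by
  have := finiteDimensional_of_etale F K
  have hι := injective_of_nucleusActionHom_injective ι a h.1
  let C : Submodule F (nucleus F A) :=
    { carrier := {r | ∀ k, ι k * r = r * ι k}
      zero_mem' := fun k => by simp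
      add_mem' := fun {x y} hx hy k => by rw [mul_add, add_mul, hx, hy]
      smul_mem' := fun c x hx k => by rw [mul_smul_comm, smul_mul_assoc, hx] }
  let ρ := nucleusActionHom ι
  let g : K →ₗ[F] A := (LinearMap.mul F A).flip (ρ (elem F K) a) ∘ₗ
    (nucleus F A).subtype ∘ₗ ι.toLinearMap
  have hρ (z : K ⊗[F] K) (x : nucleus F A) (hx : x ∈ C) :
      ρ z x.1 = (x * ι (Algebra.TensorProduct.lmul' F z)).1 := by
    induction z with
    | zero => simp
    | add z w hz hw => simp only [map_add, LinearMap.add_apply, hz, hw, mul_add]; rfl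
    | tmul k k' =>
      rw [nucleusActionHom_tmul, Algebra.TensorProduct.lmul'_apply_tmul, map_mul, ← mul_assoc,
        ← hx k]
      rfl
  -- Right factors slide across the separability element, so `K ⊗ K` acts on it through `K`.
  have helem (z : K ⊗[F] K) :
      z * elem F K = (Algebra.TensorProduct.lmul' F z ⊗ₜ 1) * elem F K := by
    induction z with
    | zero => simp
    | add z w hz hw => rw [add_mul, hz, hw, map_add, TensorProduct.add_tmul, add_mul]
    | tmul k k' =>
      have : k ⊗ₜ[F] k' = k ⊗ₜ 1 * 1 ⊗ₜ k' := by simp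
      rw [this, mul_assoc, one_tmul_mul_elem, ← mul_assoc]
      simp
  -- Write a centralizing `x` as `z a`. Then `x = e x = z (e a) = μ(z) · (e a)`, so the centralizer
  -- has dimension at most that of `K`.
  have hCg : C.map (nucleus F A).subtype ≤ LinearMap.range g := by
    rintro _ ⟨x, hx, rfl⟩
    obtain ⟨z, hz⟩ := h.2 x.1
    have hz : ρ z a = x.1 := hz
    have h1 := hρ (elem F K) x hx
    rw [lmul_elem, map_one, mul_one, ← hz, ← Module.End.mul_apply, ← map_mul, mul_comm,
      helem, map_mul, Module.End.mul_apply, nucleusActionHom_tmul, map_one] at h1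
    refine ⟨Algebra.TensorProduct.lmul' F z, ?_⟩
    rw [Submodule.subtype_apply, ← hz, ← h1]
    exact (mul_one _).symm
  have hιC : LinearMap.range ι.toLinearMap ≤ C := by
    rintro _ ⟨k, rfl⟩ k'
    change ι k' * ι k = ι k * ι k'
    rw [← map_mul, mul_comm, map_mul]
  have : FiniteDimensional F (C.map (nucleus F A).subtype) :=
    Submodule.finiteDimensional_of_le hCg
  have hCe := (Submodule.equivMapOfInjective (nucleus F A).subtype
    (nucleus F A).injective_subtype C)
  have : FiniteDimensional F C := hCe.symm.finiteDimensional
  have h2 : Module.finrank F C ≤ Module.finrank F K := by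
    rw [hCe.finrank_eq]
    exact (Submodule.finrank_mono hCg).trans (LinearMap.finrank_range_le g)
  have h3 : LinearMap.range ι.toLinearMap = C := by
    refine Submodule.eq_of_le_of_finrank_le hιC ?_
    rw [LinearMap.finrank_range_of_inj hι]
    exact h2
  have hrC : r ∈ LinearMap.range ι.toLinearMap := h3 ▸ hr
  exact hrC

/-- The étale subalgebra embeds into the semisimple quotient of the nucleus. -/
theorem mkₐ_comp_injective [FiniteDimensional F A] [Algebra.Etale F K] (ι : K →ₐ[F] nucleus F A)
    (hι : Function.Injective ι) : Function.Injective
      ((Ideal.Quotient.mkₐ F (Ring.jacobson (nucleus F A))).comp ι) := by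
  rw [injective_iff_map_eq_zero]
  intro k hk
  have hk : ι k ∈ Ring.jacobson (nucleus F A) := Ideal.Quotient.eq_zero_iff_mem.1 hk
  have : IsArtinianRing (nucleus F A) := IsArtinianRing.of_finite F _
  obtain ⟨n, hn⟩ := IsSemiprimaryRing.isNilpotent (R := nucleus F A)
  -- The radical is nilpotent, so a kernel element is nilpotent in the reduced ring `K`.
  have hp : ι (k ^ n) = 0 := by
    have := Ideal.pow_mem_pow hk n
    rw [hn] at this
    rw [map_pow]
    exact this
  have : IsReduced K := Algebra.FormallyUnramified.isReduced_of_field F _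
  exact eq_zero_of_pow_eq_zero (hι (hp.trans (map_zero ι).symm))

end EtaleWitness

/-! ### Separability of `σ(A)` and semisimplicity of `σ(A) ⊗ σ(B)` -/

section SemisimpleQuotient

variable {F : Type u} [Field F] {A : Type v} [NonAssocRing A] [Module F A]
  [SMulCommClass F A A] [IsScalarTower F A A]

theorem isSemisimpleRing_semisimpleQuotient [FiniteDimensional F A] :
    IsSemisimpleRing (SemisimpleQuotient F A) := by
  have : IsArtinianRing (nucleus F A) := IsArtinianRing.of_finite F _
  exact IsSemiprimaryRing.isSemisimpleRing

theorem IsSemiassociative.exists_selfCentralizing (h : IsSemiassociative F A) :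
    ∃ (K : Type v) (_ : CommRing K) (_ : Algebra F K) (_ : Algebra.Etale F K)
      (ι : K →ₐ[F] SemisimpleQuotient F A), Function.Injective ι ∧
        ∀ s, (∀ k, ι k * s = s * ι k) → s ∈ ι.range := by
  have := h.finite
  obtain ⟨K, _, _, _, ι, a, ha⟩ := h.exists_bijective
  exact ⟨K, inferInstance, inferInstance, inferInstance, _,
    mkₐ_comp_injective ι (injective_of_nucleusActionHom_injective ι a ha.1),
    mem_range_of_commute_of_surjective ι _ (Ideal.Quotient.mkₐ_surjective F _)
      (mem_range_of_commute ι a ha)⟩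

theorem IsSemiassociative.isSeparableAlgebra (h : IsSemiassociative F A) :
    IsSeparableAlgebra F (SemisimpleQuotient F A) := by
  have := h.finite
  have := isSemisimpleRing_semisimpleQuotient (F := F) (A := A)
  obtain ⟨K, _, _, _, ι, hι, hC⟩ := h.exists_selfCentralizing
  exact isSeparableAlgebra_of_selfCentralizing ι hι hC

theorem IsSemiassociative.isSemisimpleRing_tensorProduct {B : Type w} [NonAssocRing B]
    [Module F B] [SMulCommClass F B B] [IsScalarTower F B B]
    (hA : IsSemiassociative F A) (hB : IsSemiassociative F B) :
    IsSemisimpleRing (SemisimpleQuotient F A ⊗[F] SemisimpleQuotient F B) := by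
  have := hA.finite
  have := hB.finite
  have := isSemisimpleRing_semisimpleQuotient (F := F) (A := A)
  have := isSemisimpleRing_semisimpleQuotient (F := F) (A := B)
  obtain ⟨K, _, _, _, ι, hι, hC⟩ := hA.exists_selfCentralizing
  obtain ⟨K', _, _, _, ι', hι', hC'⟩ := hB.exists_selfCentralizing
  exact _root_.isSemisimpleRing_tensorProduct ι hι hC ι' hι' hC'

end SemisimpleQuotient

/-! ### The radical of a tensor product of associative algebras -/

section TensorJacobson

/-- A left ideal consisting of nilpotent elements is contained in the Jacobson radical. -/
theorem le_jacobson_of_isNilpotent {T : Type*} [Ring T] (L : Ideal T)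
    (hL : ∀ y ∈ L, IsNilpotent y) : L ≤ Ring.jacobson T := by
  intro x hx
  rw [Ring.jacobson_eq_sInf_isMaximal, Ideal.mem_sInf]
  intro m hm
  by_contra hxm
  obtain ⟨t, i, hi, hti⟩ := Ideal.IsMaximal.exists_inv (hI := hm) hxm
  -- Here `i = 1 - t x` with `t x ∈ L` nilpotent.
  have hu : IsUnit i := by
    have := (hL _ (L.mul_mem_left t hx)).isUnit_one_sub
    rwa [← hti, add_sub_cancel_left] at this
  exact hm.ne_top (m.eq_top_of_isUnit_mem hi hu)

variable {F : Type*} [Field F] {R R' : Type*} [Ring R] [Algebra F R] [Ring R'] [Algebra F R']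

/-- The images of `Jac(R)ⁿ ⊗ R'` form a multiplicative filtration that reaches zero, so the first
step is an ideal of nilpotent elements. -/
theorem tmul_mem_jacobson_of_left [FiniteDimensional F R] {j : R} (hj : j ∈ Ring.jacobson R)
    (r : R') : j ⊗ₜ[F] r ∈ Ring.jacobson (R ⊗[F] R') := by
  have : IsArtinianRing R := IsArtinianRing.of_finite F _
  obtain ⟨n, hn⟩ := IsSemiprimaryRing.isNilpotent (R := R)
  let P (n : ℕ) : Submodule F (R ⊗[F] R') :=
    Submodule.map₂ (TensorProduct.mk F R R') ((Ring.jacobson R ^ n).restrictScalars F) ⊤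
  have hPmul (m n : ℕ) {x y : R ⊗[F] R'} (hx : x ∈ P m) (hy : y ∈ P n) : x * y ∈ P (m + n) := by
    have h1 : P m ≤ (P (m + n)).comap (LinearMap.mulRight F y) := by
      refine Submodule.map₂_le.2 fun a ha b _ => ?_
      have h2 : P n ≤ (P (m + n)).comap (LinearMap.mulLeft F (a ⊗ₜ b)) := by
        refine Submodule.map₂_le.2 fun a' ha' b' _ => ?_
        refine Submodule.mem_comap.2 ?_
        rw [LinearMap.mulLeft_apply, TensorProduct.mk_apply, Algebra.TensorProduct.tmul_mul_tmul]
        refine Submodule.apply_mem_map₂ _ ?_ Submodule.mem_top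
        change a * a' ∈ Ring.jacobson R ^ (m + n)
        rw [Ideal.IsTwoSided.pow_add]
        exact Ideal.mul_mem_mul ha ha'
      exact h2 hy
    exact h1 hx
  have hP0 : P 0 = ⊤ := by
    refine eq_top_iff.2 fun x _ => ?_
    induction x with
    | zero => exact zero_mem _
    | add x y hx hy => exact add_mem (hx trivial) (hy trivial)
    | tmul a b =>
      exact Submodule.apply_mem_map₂ _ (by simp [Submodule.pow_zero]) Submodule.mem_top
  have hPn : P n = ⊥ := by
    simp only [P, hn]
    exact Submodule.map₂_bot_left _ _
  let L : Ideal (R ⊗[F] R') :=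
    { P 1 with
      smul_mem' := fun c x hx => by
        have := hPmul 0 1 (hP0 ▸ Submodule.mem_top : c ∈ P 0) hx
        rwa [zero_add] at this }
  refine le_jacobson_of_isNilpotent L (fun y hy => ⟨n, ?_⟩)
    (Submodule.apply_mem_map₂ _ ((Submodule.pow_one (Ring.jacobson R)).symm ▸ hj) Submodule.mem_top)
  have hpow (k : ℕ) : y ^ k ∈ P k := by
    induction k with
    | zero => rw [hP0]; trivial
    | succ k ih => rw [pow_succ]; exact hPmul k 1 ih hy
  simpa [hPn] using hpow n

theorem mem_jacobson_of_ringEquiv {T T' : Type*} [Ring T] [Ring T'] (e : T ≃+* T') {x : T}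
    (hx : x ∈ Ring.jacobson T) : e x ∈ Ring.jacobson T' := by
  have : RingHomSurjective e.toRingHom := ⟨e.surjective⟩
  exact Ring.le_comap_jacobson e.toRingHom hx

theorem ringEquiv_mem_jacobson_iff {T T' : Type*} [Ring T] [Ring T'] (e : T ≃+* T') {x : T} :
    e x ∈ Ring.jacobson T' ↔ x ∈ Ring.jacobson T :=
  ⟨fun h => by simpa using mem_jacobson_of_ringEquiv e.symm h, mem_jacobson_of_ringEquiv e⟩

theorem tmul_mem_jacobson_of_right [FiniteDimensional F R'] (r : R) {j : R'}
    (hj : j ∈ Ring.jacobson R') : r ⊗ₜ[F] j ∈ Ring.jacobson (R ⊗[F] R') :=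
  mem_jacobson_of_ringEquiv (Algebra.TensorProduct.comm F R' R).toRingEquiv
    (tmul_mem_jacobson_of_left hj r)

variable (F R R') in
/-- The projection `R ⊗ R' → R / Jac R ⊗ R' / Jac R'`. -/
noncomputable def tensorJacobsonProj :
    R ⊗[F] R' →ₐ[F] (R ⧸ Ring.jacobson R) ⊗[F] (R' ⧸ Ring.jacobson R') :=
  Algebra.TensorProduct.map (Ideal.Quotient.mkₐ F _) (Ideal.Quotient.mkₐ F _)

variable (F R R') in
theorem tensorJacobsonProj_surjective : Function.Surjective (tensorJacobsonProj F R R') :=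
  TensorProduct.map_surjective (Ideal.Quotient.mkₐ_surjective F _)
    (Ideal.Quotient.mkₐ_surjective F _)

variable (F R) in
theorem exact_subtype_jacobson_mkₐ :
    Function.Exact ((Ring.jacobson R).restrictScalars F).subtype
      (Ideal.Quotient.mkₐ F (Ring.jacobson R)).toLinearMap := fun x => by
  rw [AlgHom.toLinearMap_apply, Ideal.Quotient.mkₐ_eq_mk, Ideal.Quotient.eq_zero_iff_mem]
  simp

variable (F R R') in
theorem ker_tensorJacobsonProj_eq_sup : LinearMap.ker (tensorJacobsonProj F R R').toLinearMap =
    LinearMap.range (((Ring.jacobson R').restrictScalars F).subtype.lTensor R) ⊔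
      LinearMap.range (((Ring.jacobson R).restrictScalars F).subtype.rTensor R') := by
  exact TensorProduct.map_ker (exact_subtype_jacobson_mkₐ F R)
    (Ideal.Quotient.mkₐ_surjective F _) (exact_subtype_jacobson_mkₐ F R')
    (Ideal.Quotient.mkₐ_surjective F _)

variable (F R R') in
/-- If `R / Jac R ⊗ R' / Jac R'` is semisimple, it is the quotient of `R ⊗ R'` by its Jacobson
radical. -/
theorem tensorJacobsonProj_eq_zero_iff [FiniteDimensional F R] [FiniteDimensional F R']
    [IsSemisimpleRing ((R ⧸ Ring.jacobson R) ⊗[F] (R' ⧸ Ring.jacobson R'))] (x : R ⊗[F] R') :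
    tensorJacobsonProj F R R' x = 0 ↔ x ∈ Ring.jacobson (R ⊗[F] R') := by
  constructor
  · intro hx
    have hx : x ∈ LinearMap.ker (tensorJacobsonProj F R R').toLinearMap := hx
    suffices h : LinearMap.ker (tensorJacobsonProj F R R').toLinearMap ≤
        (Ring.jacobson (R ⊗[F] R')).restrictScalars F from h hx
    rw [ker_tensorJacobsonProj_eq_sup, sup_le_iff]
    constructor
    · rintro _ ⟨y, rfl⟩
      induction y with
      | zero => simp
      | add x y hx hy => simpa using add_mem hx hy
      | tmul a b => exact tmul_mem_jacobson_of_right a b.2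
    · rintro _ ⟨y, rfl⟩
      induction y with
      | zero => simp
      | add x y hx hy => simpa using add_mem hx hy
      | tmul a b => exact tmul_mem_jacobson_of_left a.2 b
  -- A surjection carries the radical into the radical, which is zero in the semisimple target.
  · intro hx
    have : RingHomSurjective (tensorJacobsonProj F R R').toRingHom :=
      ⟨tensorJacobsonProj_surjective F R R'⟩
    have := Ring.le_comap_jacobson (tensorJacobsonProj F R R').toRingHom hx
    rw [IsSemisimpleRing.jacobson_eq_bot
      ((R ⧸ Ring.jacobson R) ⊗[F] (R' ⧸ Ring.jacobson R'))] at this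
    exact this

end TensorJacobson

/-! ### Radical of the nucleus and `σ` of a tensor product -/

section SemisimpleQuotientTensor

variable {F : Type u} [Field F] {A : Type v} {B : Type w}
  [NonAssocRing A] [Module F A] [SMulCommClass F A A] [IsScalarTower F A A]
  [NonAssocRing B] [Module F B] [SMulCommClass F B B] [IsScalarTower F B B]

theorem mem_radNucleus_iff {x : A} :
    x ∈ radNucleus F A ↔ ∃ y ∈ Ring.jacobson (nucleus F A), (y : A) = x := by
  simp only [radNucleus, Submodule.mem_map]
  rfl

theorem radNucleus_tensorProduct (hA : IsSemiassociative F A) (hB : IsSemiassociative F B) :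
    radNucleus F (A ⊗[F] B) =
      Submodule.map₂ (TensorProduct.mk F A B) (radNucleus F A) (nucleus F B) ⊔
        Submodule.map₂ (TensorProduct.mk F A B) (nucleus F A) (radNucleus F B) := by
  have := hA.finite
  have := hB.finite
  have := hA.isSemisimpleRing_tensorProduct hB
  apply le_antisymm
  · intro x hx
    obtain ⟨y, hy, rfl⟩ := mem_radNucleus_iff.1 hx
    obtain ⟨z, rfl⟩ := (nucleusTensorEquiv F A B).surjective y
    rw [coe_nucleusTensorEquiv]
    have hz : z ∈ Ring.jacobson (nucleus F A ⊗[F] nucleus F B) :=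
      (ringEquiv_mem_jacobson_iff (nucleusTensorEquiv F A B).toRingEquiv).1 hy
    rw [← tensorJacobsonProj_eq_zero_iff] at hz
    have hz' : z ∈ LinearMap.ker
        (tensorJacobsonProj F (nucleus F A) (nucleus F B)).toLinearMap := hz
    rw [ker_tensorJacobsonProj_eq_sup] at hz'
    obtain ⟨_, ⟨p, rfl⟩, _, ⟨q, rfl⟩, rfl⟩ := Submodule.mem_sup.1 hz'
    rw [map_add, add_comm]
    clear hx hy hz hz'
    refine Submodule.add_mem_sup ?_ ?_
    · induction q with
      | zero => simp
      | add x y hx hy => simpa using add_mem hx hy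
      | tmul a b =>
        exact Submodule.apply_mem_map₂ _ (mem_radNucleus_iff.2 ⟨a.1, a.2, rfl⟩) b.2
    · induction p with
      | zero => simp
      | add x y hx hy => simpa using add_mem hx hy
      | tmul a b =>
        exact Submodule.apply_mem_map₂ _ a.2 (mem_radNucleus_iff.2 ⟨b.1, b.2, rfl⟩)
  · rw [sup_le_iff, Submodule.map₂_le, Submodule.map₂_le]
    constructor
    · intro a ha b hb
      obtain ⟨a, ha', rfl⟩ := mem_radNucleus_iff.1 ha
      exact mem_radNucleus_iff.2 ⟨nucleusTensorEquiv F A B (a ⊗ₜ ⟨b, hb⟩),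
        mem_jacobson_of_ringEquiv (nucleusTensorEquiv F A B).toRingEquiv
          (tmul_mem_jacobson_of_left ha' _), rfl⟩
    · intro a ha b hb
      obtain ⟨b, hb', rfl⟩ := mem_radNucleus_iff.1 hb
      exact mem_radNucleus_iff.2 ⟨nucleusTensorEquiv F A B (⟨a, ha⟩ ⊗ₜ b),
        mem_jacobson_of_ringEquiv (nucleusTensorEquiv F A B).toRingEquiv
          (tmul_mem_jacobson_of_right _ hb'), rfl⟩

theorem nonempty_semisimpleQuotient_tensorProduct_algEquiv
    (hA : IsSemiassociative F A) (hB : IsSemiassociative F B) :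
    Nonempty (SemisimpleQuotient F (A ⊗[F] B) ≃ₐ[F]
      SemisimpleQuotient F A ⊗[F] SemisimpleQuotient F B) := by
  have := hA.finite
  have := hB.finite
  have := hA.isSemisimpleRing_tensorProduct hB
  let g : nucleus F (A ⊗[F] B) →ₐ[F] SemisimpleQuotient F A ⊗[F] SemisimpleQuotient F B :=
    (tensorJacobsonProj F (nucleus F A) (nucleus F B)).comp (nucleusTensorEquiv F A B).symm.toAlgHom
  have hg : Function.Surjective g :=
    (tensorJacobsonProj_surjective F _ _).comp (nucleusTensorEquiv F A B).symm.surjective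
  have hker : Ring.jacobson (nucleus F (A ⊗[F] B)) = RingHom.ker g := by
    ext x
    rw [RingHom.mem_ker]
    change _ ↔ tensorJacobsonProj F _ _ ((nucleusTensorEquiv F A B).symm x) = 0
    rw [tensorJacobsonProj_eq_zero_iff]
    exact (ringEquiv_mem_jacobson_iff (nucleusTensorEquiv F A B).symm.toRingEquiv).symm
  exact ⟨(Ideal.quotientEquivAlgOfEq F hker).trans (Ideal.quotientKerAlgEquivOfSurjective hg)⟩

end SemisimpleQuotientTensor

/-! ### Tensor products, the unit and isomorphism invariance -/

section SemiassociativeConstructions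

variable {F : Type u} [Field F] {A : Type v} {B : Type w}
  [NonAssocRing A] [Module F A] [SMulCommClass F A A] [IsScalarTower F A A]
  [NonAssocRing B] [Module F B] [SMulCommClass F B B] [IsScalarTower F B B]

/-- The tensor product of semiassociative algebras is semiassociative. -/
theorem IsSemiassociative.tensorProduct (hA : IsSemiassociative F A)
    (hB : IsSemiassociative F B) : IsSemiassociative F (A ⊗[F] B) := by
  have := hA.nontrivial
  have := hB.nontrivial
  have := hA.finite
  have := hB.finite
  obtain ⟨K, _, _, _, ι, a, ha⟩ := hA.exists_bijective
  obtain ⟨K', _, _, _, ι', b, hb⟩ := hB.exists_bijective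
  have : Algebra.Etale F (K ⊗[F] K') := etale_tensorProduct
  refine ⟨inferInstance, inferInstance, center_tensorProduct hA.central hB.central,
    exists_etale_of_bijective ((nucleusTensorEquiv F A B).toAlgHom.comp
      (Algebra.TensorProduct.map ι ι')) (a ⊗ₜ b) ?_⟩
  let f : K ⊗[F] K ≃ₗ[F] A :=
    LinearEquiv.ofBijective ((nucleusActionHom ι).toLinearMap.flip a) ha
  let f' : K' ⊗[F] K' ≃ₗ[F] B :=
    LinearEquiv.ofBijective ((nucleusActionHom ι').toLinearMap.flip b) hb
  have hΘ (k : K) (k' : K') : ((nucleusTensorEquiv F A B).toAlgHom.comp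
      (Algebra.TensorProduct.map ι ι') (k ⊗ₜ k')).1 = (ι k).1 ⊗ₜ (ι' k').1 := rfl
  -- After the middle factors are interchanged, the orbit map of `a ⊗ b` under `K ⊗ K'` is the
  -- tensor product of the orbit maps of `a` and `b`.
  let c := TensorProduct.tensorTensorTensorComm F K K K' K'
  have key : (fun z => nucleusActionHom ((nucleusTensorEquiv F A B).toAlgHom.comp
      (Algebra.TensorProduct.map ι ι')) z (a ⊗ₜ b)) ∘ c = TensorProduct.congr f f' := by
    funext z
    rw [Function.comp_apply]
    induction z with
    | zero => simp
    | add x y hx hy => simp only [map_add, LinearMap.add_apply, hx, hy]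
    | tmul z w =>
      induction z with
      | zero => simp
      | add x y hx hy => simp only [TensorProduct.add_tmul, map_add, LinearMap.add_apply, hx, hy]
      | tmul k l =>
        induction w with
        | zero => simp
        | add x y hx hy =>
          simp only [TensorProduct.tmul_add, map_add, LinearMap.add_apply, hx, hy]
        | tmul k' l' =>
          have h1 : f (k ⊗ₜ l) = (ι k).1 * a * (ι l).1 := nucleusActionHom_tmul ι k l a
          have h2 : f' (k' ⊗ₜ l') = (ι' k').1 * b * (ι' l').1 := nucleusActionHom_tmul ι' k' l' b
          rw [TensorProduct.congr_tmul, h1, h2, TensorProduct.tensorTensorTensorComm_tmul,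
            nucleusActionHom_tmul, hΘ, hΘ, Algebra.TensorProduct.tmul_mul_tmul,
            Algebra.TensorProduct.tmul_mul_tmul]
  rw [← Function.Bijective.of_comp_iff _ c.bijective, key]
  exact (TensorProduct.congr f f').bijective

variable (F) in
theorem isSemiassociative_self : IsSemiassociative F F := by
  refine ⟨inferInstance, inferInstance, ?_,
    exists_etale_of_bijective (Algebra.ofId F (nucleus F F)) 1 ?_⟩
  · rw [Set.center_eq_univ, eq_comm, Set.range_eq_univ]
    exact fun c => ⟨c, by simp⟩
  · convert (TensorProduct.lid F F).bijective with z
    induction z with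
    | zero => simp
    | add x y hx hy => simp only [map_add, LinearMap.add_apply, hx, hy]
    | tmul k k' =>
      have h (k : F) : (Algebra.ofId F (nucleus F F) k).1 = k := by
        rw [Algebra.ofId_apply, Algebra.algebraMap_eq_smul_one]
        exact mul_one k
      rw [nucleusActionHom_tmul, h, h]
      simp

theorem map_one_of_map_mul {F A B : Type*} [Field F] [NonAssocRing A] [Module F A]
    [NonAssocRing B] [Module F B] (e : A ≃ₗ[F] B) (he : ∀ x y, e (x * y) = e x * e y) :
    e 1 = 1 := by
  rw [← mul_one (e 1), ← e.apply_symm_apply 1, ← he, one_mul]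

theorem map_mem_nucleus (e : A ≃ₗ[F] B) (he : ∀ x y, e (x * y) = e x * e y) {x : A}
    (hx : x ∈ nucleus F A) : e x ∈ nucleus F B := by
  rw [mem_nucleus_iff] at *
  obtain ⟨h1, h2, h3⟩ := hx
  refine ⟨fun a b => ?_, fun a b => ?_, fun a b => ?_⟩ <;>
  · obtain ⟨a, rfl⟩ := e.surjective a
    obtain ⟨b, rfl⟩ := e.surjective b
    simp only [← he, h1, h2, h3]

/-- An isomorphism of nonassociative algebras restricts to the nuclei. -/
noncomputable def nucleusCongr (e : A ≃ₗ[F] B) (he : ∀ x y, e (x * y) = e x * e y) :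
    nucleus F A ≃ₐ[F] nucleus F B :=
  AlgEquiv.ofLinearEquiv
    (LinearEquiv.ofSubmodules e (nucleus F A) (nucleus F B) (by
      apply le_antisymm
      · rintro _ ⟨x, hx, rfl⟩
        exact map_mem_nucleus e he hx
      · intro x hx
        exact ⟨e.symm x, map_mem_nucleus e.symm (fun x y => e.injective (by simp [he])) hx,
          e.apply_symm_apply x⟩))
    (Subtype.ext (map_one_of_map_mul e he)) (fun x y => Subtype.ext (he x.1 y.1))

/-- Semiassociativity is invariant under isomorphism. -/
theorem IsSemiassociative.of_linearEquiv (e : A ≃ₗ[F] B) (he : ∀ x y, e (x * y) = e x * e y)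
    (h : IsSemiassociative F A) : IsSemiassociative F B := by
  have := h.nontrivial
  have := h.finite
  obtain ⟨K, _, _, _, ι, a, ha⟩ := h.exists_bijective
  refine ⟨e.symm.toEquiv.nontrivial, e.finiteDimensional, ?_,
    exists_etale_of_bijective ((nucleusCongr e he).toAlgHom.comp ι) (e a) ?_⟩
  · apply Set.Subset.antisymm
    · intro x hx
      obtain ⟨hxn, hxc⟩ := mem_center_iff_mem_nucleus (F := F).1 hx
      have hes : ∀ x y, e.symm (x * y) = e.symm x * e.symm y :=
        fun x y => e.injective (by simp [he])
      have : e.symm x ∈ Set.center A := mem_center_iff_mem_nucleus.2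
        ⟨map_mem_nucleus e.symm hes hxn, fun a => by
          obtain ⟨a, rfl⟩ := e.symm.surjective a
          rw [← hes, ← hes, hxc]⟩
      rw [h.central] at this
      obtain ⟨c, hc⟩ := this
      refine ⟨c, ?_⟩
      have hc := congrArg e hc
      rwa [map_smul, map_one_of_map_mul e he, e.apply_symm_apply] at hc
    · rintro _ ⟨c, rfl⟩
      exact smul_one_mem_center c
  · have key : (fun z => nucleusActionHom ((nucleusCongr e he).toAlgHom.comp ι) z (e a)) =
        e ∘ fun z => nucleusActionHom ι z a := by
      funext z
      rw [Function.comp_apply]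
      induction z with
      | zero => simp
      | add x y hx hy => simp only [map_add, LinearMap.add_apply, hx, hy]
      | tmul k k' =>
        rw [nucleusActionHom_tmul, nucleusActionHom_tmul, he, he]
        rfl
    rw [key]
    exact e.bijective.comp ha

/-- Isomorphic nonassociative algebras have isomorphic semisimple quotients of the nuclei. -/
theorem nonempty_semisimpleQuotient_algEquiv (e : A ≃ₗ[F] B)
    (he : ∀ x y, e (x * y) = e x * e y) :
    Nonempty (SemisimpleQuotient F A ≃ₐ[F] SemisimpleQuotient F B) := by
  refine ⟨Ideal.quotientEquivAlg _ _ (nucleusCongr e he) ?_⟩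
  apply le_antisymm
  · intro x hx
    obtain ⟨x, rfl⟩ := (nucleusCongr e he).surjective x
    exact Ideal.mem_map_of_mem _
      ((ringEquiv_mem_jacobson_iff (nucleusCongr e he).toRingEquiv).1 hx)
  · rw [Ideal.map_le_iff_le_comap]
    exact fun x hx => mem_jacobson_of_ringEquiv (nucleusCongr e he).toRingEquiv hx

variable (F) in
theorem nonempty_semisimpleQuotient_self_algEquiv :
    Nonempty (SemisimpleQuotient F F ≃ₐ[F] F) := by
  have : Nontrivial (nucleus F F) :=
    ⟨0, 1, fun h => zero_ne_one (α := F) (congrArg Subtype.val h)⟩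
  have : Nontrivial (SemisimpleQuotient F F) :=
    Ideal.Quotient.nontrivial_iff.2 (Ring.jacobson_lt_top _).ne
  refine ⟨(AlgEquiv.ofBijective (Algebra.ofId F (SemisimpleQuotient F F))
    ⟨(algebraMap F (SemisimpleQuotient F F)).injective, fun x => ?_⟩).symm⟩
  obtain ⟨x, rfl⟩ := Ideal.Quotient.mkₐ_surjective F _ x
  refine ⟨x.1, ?_⟩
  have hx : x = algebraMap F (nucleus F F) x.1 := by
    rw [Algebra.algebraMap_eq_smul_one]
    exact Subtype.ext (mul_one x.1).symm
  rw [Algebra.ofId_apply]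
  conv_rhs => rw [hx]
  exact ((Ideal.Quotient.mkₐ F (Ring.jacobson (nucleus F F))).commutes x.1).symm

end SemiassociativeConstructions

/-! ### The monoids of classes and the homomorphism between them -/

section ClassMonoids

variable (F : Type u) [Field F]

/-- The monoid of isomorphism classes of semiassociative algebras. -/
def semiassociativeSubmonoid : Submonoid (NonassocClass F) where
  carrier := {c | ∃ A : NonassocAlg F, IsSemiassociative F A.carrier ∧ NonassocClass.mk A = c}
  one_mem' := ⟨⟨F⟩, isSemiassociative_self F, rfl⟩
  mul_mem' := by
    rintro _ _ ⟨A, hA, rfl⟩ ⟨B, hB, rfl⟩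
    exact ⟨A.tensor B, hA.tensorProduct hB, rfl⟩

/-- The monoid of isomorphism classes of separable algebras. -/
def separableSubmonoid : Submonoid (AssocClass F) where
  carrier := {c | ∃ R : AssocAlg F, IsSeparableAlgebra F R.carrier ∧ AssocClass.mk R = c}
  one_mem' := ⟨⟨F⟩, isSeparableAlgebra_self F, rfl⟩
  mul_mem' := by
    rintro _ _ ⟨A, hA, rfl⟩ ⟨B, hB, rfl⟩
    exact ⟨A.tensor B, hA.tensorProduct hB, rfl⟩

variable {F}

/-- Membership only asks for some semiassociative representative; isomorphism invariance makes it a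
property of each one. -/
theorem mk_mem_semiassociativeSubmonoid {A : NonassocAlg F} :
    NonassocClass.mk A ∈ semiassociativeSubmonoid F ↔ IsSemiassociative F A.carrier := by
  refine ⟨?_, fun h => ⟨A, h, rfl⟩⟩
  rintro ⟨B, hB, hBA⟩
  obtain ⟨e, he⟩ : NonassocIso F B.carrier A.carrier := Quotient.exact hBA
  exact hB.of_linearEquiv e he

theorem mk_mem_separableSubmonoid {R : AssocAlg F} :
    AssocClass.mk R ∈ separableSubmonoid F ↔ IsSeparableAlgebra F R.carrier := by
  refine ⟨?_, fun h => ⟨R, h, rfl⟩⟩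
  rintro ⟨Q, hQ, hQR⟩
  obtain ⟨e⟩ : Nonempty (Q.carrier ≃ₐ[F] R.carrier) := Quotient.exact hQR
  exact hQ.of_algEquiv e

variable (F) in
/-- The map `[A] ↦ [σ(A)]` on isomorphism classes of nonassociative algebras. -/
def sigmaClass : NonassocClass F → AssocClass F :=
  Quotient.lift (fun A => AssocClass.mk A.sigma) fun _ _ ⟨e, he⟩ =>
    Quotient.sound (nonempty_semisimpleQuotient_algEquiv e he)

variable (F) in
/-- The monoid homomorphism `[A] ↦ [σ(A)]` from semiassociative to separable algebras. -/
def sigmaHom : semiassociativeSubmonoid F →* separableSubmonoid F where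
  toFun c := ⟨sigmaClass F c.1, by
    obtain ⟨_, A, hA, rfl⟩ := c
    exact ⟨A.sigma, hA.isSeparableAlgebra, rfl⟩⟩
  map_one' := Subtype.ext (Quotient.sound (nonempty_semisimpleQuotient_self_algEquiv F))
  map_mul' := by
    rintro ⟨_, A, hA, rfl⟩ ⟨_, B, hB, rfl⟩
    exact Subtype.ext
      (Quotient.sound (nonempty_semisimpleQuotient_tensorProduct_algEquiv hA hB))

end ClassMonoids

theorem mainTheorem9 (F : Type u) [Field F] :
    (∀ (A : Type v) (B : Type w)
      [NonAssocRing A] [Module F A] [SMulCommClass F A A] [IsScalarTower F A A]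
      [NonAssocRing B] [Module F B] [SMulCommClass F B B] [IsScalarTower F B B],
      IsSemiassociative F A → IsSemiassociative F B →
        radNucleus F (A ⊗[F] B) =
            Submodule.map₂ (TensorProduct.mk F A B) (radNucleus F A) (nucleus F B) ⊔
              Submodule.map₂ (TensorProduct.mk F A B) (nucleus F A) (radNucleus F B) ∧
          Nonempty (SemisimpleQuotient F (A ⊗[F] B) ≃ₐ[F]
            SemisimpleQuotient F A ⊗[F] SemisimpleQuotient F B)) ∧
    ∃ (M : Submonoid (NonassocClass F)) (S : Submonoid (AssocClass F)) (s : M →* S),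
      (∀ A : NonassocAlg F, NonassocClass.mk A ∈ M ↔ IsSemiassociative F A.carrier) ∧
      (∀ R : AssocAlg F, AssocClass.mk R ∈ S ↔ IsSeparableAlgebra F R.carrier) ∧
      ∀ (A : NonassocAlg F) (hA : NonassocClass.mk A ∈ M),
        (s ⟨NonassocClass.mk A, hA⟩ : AssocClass F) = AssocClass.mk A.sigma :=
  ⟨fun _ _ _ _ _ _ _ _ _ _ hA hB => ⟨radNucleus_tensorProduct hA hB,
      nonempty_semisimpleQuotient_tensorProduct_algEquiv hA hB⟩,
    semiassociativeSubmonoid F, separableSubmonoid F, sigmaHom F,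
    fun _ => mk_mem_semiassociativeSubmonoid, fun _ => mk_mem_separableSubmonoid,
    fun _ _ => rfl⟩
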